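/- Let $p$ be a prime and let $K$ be a finite extension of $\mathbb{Q}_p$ containing the group $\mu_p$ of $p$th roots of unity. Fix an algebraic closure $\overline{K}$ of $K$, and let $v$ be the valuation on $\overline{K}$ normalized by $v(p)=1$, with $v(0)=\infty$. Let $c \in K^\times$ and $a \in K$, and let $f(z)=z^p-c$. For $n \ge 0$ let $K_n \subseteq \overline{K}$ be the extension of $K$ generated by the solutions in $\overline{K}$ of $f^n(z)=a$, where $f^n$ is the $n$th iterate of $f$, and let $K_\infty=\bigcup_n K_n$. For $0 \le n \le \infty$ let $G(n)=\operatorname{Aut}(K_n/K)$ and let $I(n)$ be the inertia subgroup of $G(n)$. Put $\nu_0=-\infty$ and $\nu_n=-\dfrac{p^{n+1}}{(p^n-1)(p-1)}$ for $n\ge 1$. Equalities between groups at different levels mean that restriction of automorphisms induces an isomorphism, and $A \le B$ between groups means that $A$ is isomorphic to a subgroup of $B$. Let $n \ge 1$. (a) Suppose that $\nu_{n-1} < v(c) < \nu_n$ and $v(a) > v(c)/p$. Then $G(\infty)=G(n)$. If $p^r$ is the largest power of $p$ such that $v(c) \in p^r v(K^\times)$, then $$p^{n-r} \le \#I(n)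 \le \#G(n) = \#G(\infty) \le p^n.$$ In particular, if $v(c) \notin p\,v(K^\times)$, then $G(\infty)=G(n)=I(\infty)=I(n) \simeq (\mathbb{Z}/p\mathbb{Z})^n$. (b) Suppose that $v(c)=\nu_n$ and $v(a) \ge v(c)/p$. Then $G(\infty)=G(n+1) \le (\mathbb{Z}/p\mathbb{Z})^{n+1}$, $I(\infty)=I(n) \le (\mathbb{Z}/p\mathbb{Z})^n$, and $G(\infty)/I(\infty) \le \mathbb{Z}/p\mathbb{Z}$. -/

import Mathlib

namespace LocalArboreal

open Classical in
/-- The valuation `v` on an algebraic extension `L` of `ℚ_p`, normalized by `v p = 1`, with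
`v 0 = ∞`. Here `spectralNorm ℚ_[p] L` is the unique absolute value on `L` extending the `p`-adic
absolute value of `ℚ_p`. -/
noncomputable def val (p : ℕ) [Fact p.Prime] {L : Type*} [Field L] [Algebra ℚ_[p] L]
    (x : L) : EReal :=
  if x = 0 then ⊤ else ((-Real.logb p (spectralNorm ℚ_[p] L x) : ℝ) : EReal)

/-- The cutoff values `ν_n = -p ^ (n + 1) / ((p ^ n - 1) * (p - 1))` for `n ≥ 1`, with the
convention `ν_0 = -∞`. -/
noncomputable def nu (p n : ℕ) : EReal :=
  if n = 0 then ⊥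
  else ((-((p : ℝ) ^ (n + 1) / (((p : ℝ) ^ n - 1) * ((p : ℝ) - 1))) : ℝ) : EReal)

section Valuation

variable (p : ℕ) [Fact p.Prime] {L : Type*} [Field L] [Algebra ℚ_[p] L]

lemma val_nonneg_iff [Algebra.IsAlgebraic ℚ_[p] L] (x : L) :
    0 ≤ val p x ↔ spectralNorm ℚ_[p] L x ≤ 1 := by
  have hp : (1 : ℝ) < p := by exact_mod_cast (Fact.out : p.Prime).one_lt
  unfold val
  split_ifs with h
  · simp [h, spectralNorm_zero]
  · have hpos := spectralNorm_zero_lt h (Algebra.IsAlgebraic.isAlgebraic (R := ℚ_[p]) x)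
    rw [EReal.coe_nonneg, neg_nonneg]
    exact Real.logb_nonpos_iff hp hpos

/-- The valuation ring `{x | 0 ≤ v x}` of an algebraic extension `L` of `ℚ_p`. -/
noncomputable def valRing (L : Type*) [Field L] [Algebra ℚ_[p] L]
    [Algebra.IsAlgebraic ℚ_[p] L] : ValuationSubring L where
  carrier := {x | 0 ≤ val p x}
  mul_mem' {x y} hx hy := by
    simp only [Set.mem_ofPred_eq, val_nonneg_iff] at *
    exact (spectralNorm_mul (Algebra.IsAlgebraic.isAlgebraic x)
      (Algebra.IsAlgebraic.isAlgebraic y)).trans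
      (mul_le_one₀ hx (spectralNorm_nonneg _) hy)
  one_mem' := by
    simp only [Set.mem_ofPred_eq, val_nonneg_iff]
    exact spectralNorm_one.le
  add_mem' {x y} hx hy := by
    simp only [Set.mem_ofPred_eq, val_nonneg_iff] at *
    exact (isNonarchimedean_spectralNorm x y).trans (max_le hx hy)
  zero_mem' := by simp [val]
  neg_mem' {x} hx := by
    simp only [Set.mem_ofPred_eq, val_nonneg_iff] at *
    rwa [spectralNorm_neg (Algebra.IsAlgebraic.isAlgebraic x)]
  mem_or_inv_mem' x := by
    simp only [Set.mem_ofPred_eq, val_nonneg_iff]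
    by_cases hx : x = 0
    · left; simp [hx, spectralNorm_zero]
    have h : spectralNorm ℚ_[p] L x * spectralNorm ℚ_[p] L x⁻¹ = 1 := by
      have := map_mul (spectralMulAlgNorm ℚ_[p] L) x x⁻¹
      rw [mul_inv_cancel₀ hx, map_one] at this
      simpa only [spectralMulAlgNorm_def] using this.symm
    by_contra! hcon
    nlinarith [hcon.1, hcon.2]

end Valuation

section Inertia

variable (p : ℕ) [Fact p.Prime] (K L : Type*) [Field K] [Algebra ℚ_[p] K] [Field L]
  [Algebra ℚ_[p] L] [Algebra.IsAlgebraic ℚ_[p] L] [Algebra K L] [IsScalarTower ℚ_[p] K L]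

/-- The inertia subgroup of `Gal(L/K)`: the automorphisms that preserve the valuation ring of `L`
(which all of them do) and act trivially on its residue field. -/
noncomputable def inertia : Subgroup Gal(L/K) :=
  ((valRing p L).inertiaSubgroup K).map ((valRing p L).decompositionSubgroup K).subtype

lemma val_galois (σ : Gal(L/K)) (x : L) : val p (σ x) = val p x := by
  have h : spectralNorm ℚ_[p] L (σ x) = spectralNorm ℚ_[p] L x :=
    (spectralNorm_eq_of_equiv (σ.restrictScalars ℚ_[p]) x).symm
  by_cases hx : x = 0
  · simp [hx]
  · have hσ : σ x ≠ 0 := by simpa using hx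
    rw [val, val, if_neg hx, if_neg hσ, h]

open scoped Pointwise in
lemma decompositionSubgroup_eq_top : (valRing p L).decompositionSubgroup K = ⊤ := by
  rw [eq_top_iff]
  intro σ _
  rw [MulAction.mem_stabilizer_iff]
  ext x
  rw [ValuationSubring.mem_pointwise_smul_iff_inv_smul_mem]
  change 0 ≤ val p (σ⁻¹ x) ↔ 0 ≤ val p x
  rw [val_galois]

instance inertia_normal : (inertia p K L).Normal := by
  have h : ((valRing p L).inertiaSubgroup K).Normal := MonoidHom.normal_ker _
  refine h.map _ ?_
  rw [Subgroup.coe_subtype, ← Set.range_eq_univ, Subtype.range_coe, decompositionSubgroup_eq_top]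
  rfl

end Inertia

section Tree

variable {K : Type*} [Field K] (Ω : Type*) [Field Ω] [Algebra K Ω]

/-- The set of solutions in `Ω` of `f^n(z) = a`, where `f(z) = z ^ ℓ - c` and `f^n` is the `n`-th
iterate of `f`. -/
def preimages (ℓ : ℕ) (c a : K) (n : ℕ) : Set Ω :=
  {α | (fun z : Ω => z ^ ℓ - algebraMap K Ω c)^[n] α = algebraMap K Ω a}

/-- `K_n`, the extension of `K` generated by the solutions of `f^n(z) = a`. -/
def fieldAt (ℓ : ℕ) (c a : K) (n : ℕ) : IntermediateField K Ω :=
  IntermediateField.adjoin K (preimages Ω ℓ c a n)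

/-- `K_∞`, the union of the increasing sequence of fields `K_n`. -/
def fieldInfty (ℓ : ℕ) (c a : K) : IntermediateField K Ω :=
  ⨆ n, fieldAt Ω ℓ c a n

lemma fieldAt_le_fieldInfty (ℓ : ℕ) (c a : K) (n : ℕ) :
    fieldAt Ω ℓ c a n ≤ fieldInfty Ω ℓ c a :=
  le_iSup (fieldAt Ω ℓ c a) n

instance fieldAt_normal [Normal K Ω] (ℓ : ℕ) (c a : K) (n : ℕ) :
    Normal K (fieldAt Ω ℓ c a n) := by
  rw [IntermediateField.normal_iff_forall_map_le]
  intro σ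
  rw [fieldAt, IntermediateField.adjoin_map]
  apply IntermediateField.adjoin.mono
  rintro _ ⟨α, hα, rfl⟩
  have hs : Function.Semiconj σ (fun z : Ω => z ^ ℓ - algebraMap K Ω c)
      (fun z : Ω => z ^ ℓ - algebraMap K Ω c) := fun z => by simp
  have h := (hs.iterate_right n).eq α
  simp only [preimages, Set.mem_ofPred_eq] at hα ⊢
  rw [← h, hα, AlgHom.commutes]

variable {Ω}

/-- The restriction homomorphism `Gal(F/K) → Gal(E/K)` for intermediate fields `E ≤ F` of `Ω/K`
with `E` normal over `K`. -/
noncomputable def res {E F : IntermediateField K Ω} (h : E ≤ F) [Normal K E] :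
    Gal(F/K) →* Gal(E/K) :=
  letI : Algebra E F := (IntermediateField.inclusion h).toAlgebra
  haveI : IsScalarTower K E F := IsScalarTower.of_algebraMap_eq fun _ => rfl
  AlgEquiv.restrictNormalHom E

/-- `res h σ` is the restriction of `σ` to `E`. -/
lemma coe_res_apply {E F : IntermediateField K Ω} (h : E ≤ F) [Normal K E]
    (σ : Gal(F/K)) (x : E) :
    (res h σ x : Ω) = σ (IntermediateField.inclusion h x) := by
  let _ : Algebra E F := (IntermediateField.inclusion h).toAlgebra
  have _ : IsScalarTower K E F := IsScalarTower.of_algebraMap_eq fun _ => rfl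
  exact congrArg Subtype.val (AlgEquiv.restrictNormal_commutes σ E x)

end Tree

section Groups

variable (p : ℕ) {K : Type*} [Field K] (Ω : Type*) [Field Ω] [Algebra K Ω]

/-- `G(n) = Aut(K_n/K)`, for `f(z) = z ^ p - c`. -/
abbrev G (c a : K) (n : ℕ) : Type _ := Gal(fieldAt Ω p c a n/K)

/-- `G(∞) = Aut(K_∞/K)`, for `f(z) = z ^ p - c`. -/
abbrev GInfty (c a : K) : Type _ := Gal(fieldInfty Ω p c a/K)

/-- The restriction map `G(∞) → G(n)`. -/
noncomputable abbrev resInfty [Normal K Ω] (c a : K) (n : ℕ) : GInfty p Ω c a →* G p Ω c a n :=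
  res (fieldAt_le_fieldInfty Ω p c a n)

variable [Fact p.Prime] [Algebra ℚ_[p] K] [Algebra ℚ_[p] Ω] [IsScalarTower ℚ_[p] K Ω]
  [Algebra.IsAlgebraic ℚ_[p] K] [Algebra.IsAlgebraic K Ω]

instance isAlgebraic_intermediateField (E : IntermediateField K Ω) :
    Algebra.IsAlgebraic ℚ_[p] E :=
  Algebra.IsAlgebraic.trans ℚ_[p] K E

/-- The inertia subgroup `I(n)` of `G(n)`. -/
noncomputable abbrev I (c a : K) (n : ℕ) : Subgroup (G p Ω c a n) :=
  inertia p K (fieldAt Ω p c a n)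

/-- The inertia subgroup `I(∞)` of `G(∞)`. -/
noncomputable abbrev IInfty (c a : K) : Subgroup (GInfty p Ω c a) :=
  inertia p K (fieldInfty Ω p c a)

end Groups

end LocalArboreal

/-!
Let `N` be the absolute value on `Ω` with `N p = p⁻¹`, and let `z 0 = a`, `z (i + 1) ^ p = c + z i`
be a branch of the tree of preimages. As `v c < 0` and `v a ≥ v c / p`, all `z (i + 1)` have
absolute value `ρ = N c ^ (1 / p)`, and two distinct `p`-th roots of the same element of
absolute value `ρ ^ p` are at distance `D = lam p * ρ`, where `lam p ^ (p - 1) = p⁻¹`. The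
hypotheses on `v c` give `D > 1`, hence `D < D ^ p`, and everything rests on the comparison of
the distance of `w` and `w'` with `D ^ p`: below `D ^ p`, each `p`-th root of `c + w` is closer than
`D` to exactly one `p`-th root of `c + w'`; above `D ^ p`, all these pairs of roots are at the same
distance, the `p`-th root of the distance of `w` and `w'`; at `D ^ p`, they are at distance at most
`D` (`exists_root_near`, `absv_sub_le_of_pow`, `absv_sub_eq_of_pow`).

* Krasner's lemma in the form `fixed_of_near` shows that `K_m = K(z 1, …, z m)` for any branch, and
  that `K_∞ = K_(n + 1)` as soon as `N (z (n + 1) - z n) < D ^ p`. The distances of consecutive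
  terms start with at most `ρ` and go down by `p`-th roots until they are below `D ^ p`; the
  cutoffs `ν_n` tell at which level this happens (`cutoff_identity`).
* For a Galois automorphism `σ` there is a unique root of unity `ξ` with
  `N (σ (z i) - ξ * z i) < D`. This gives characters `IsBranch.chi` of the Galois group, whose
  common kernel for `i ≤ m` fixes `K_m`. So `G(m)` embeds into `(ℤ/pℤ)^m`.
* Under the hypotheses of (a), `N (z n - z (n - 1)) = N c ^ (1 / p ^ n)` exactly, and
  `exists_absv_eq_pow_card_inertia` (the `#I`-th powers of values of `K_n` are values of `K`) gives
  the lower bound for the order of inertia.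
* If `v c = ν_n`, then `N (z n - z (n - 1)) ≤ D ^ p`, and the extension `K_(n + 1) / K_n` is
  unramified, given by an Artin-Schreier equation on residue fields (`IsBranch.fixed_of_inertia`).
  So inertia restricts injectively to `K_n`; it restricts surjectively by
  `exists_mul_mem_inertia`, and the quotient by inertia is cyclic of exponent `p`
  (`exists_quotient_inertia_injective`).
-/

namespace LocalArboreal

/-! ### The absolute value -/

section AbsoluteValue

variable (p : ℕ) [Fact p.Prime] (L : Type*) [Field L] [Algebra ℚ_[p] L]
  [Algebra.IsAlgebraic ℚ_[p] L]

/-- The absolute value on an algebraic extension `L` of `ℚ_p` that extends the `p`-adic one. -/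
noncomputable def absv : AbsoluteValue L ℝ where
  toFun := spectralNorm ℚ_[p] L
  map_mul' := map_mul (spectralMulAlgNorm ℚ_[p] L)
  nonneg' := spectralNorm_nonneg
  eq_zero' x := ⟨fun h => eq_zero_of_map_spectralNorm_eq_zero h
    (Algebra.IsAlgebraic.isAlgebraic x), fun h => by rw [h, spectralNorm_zero]⟩
  add_le' x y := isNonarchimedean_spectralNorm.add_le spectralNorm_nonneg

variable {L}

lemma absv_def (x : L) : absv p L x = spectralNorm ℚ_[p] L x := rfl

lemma absv_nonarch : IsNonarchimedean (absv p L) := isNonarchimedean_spectralNorm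

variable {p} in
lemma absv_sub_le {x y : L} {r : ℝ} (hx : absv p L x ≤ r) (hy : absv p L y ≤ r) :
    absv p L (x - y) ≤ r := by
  rw [sub_eq_add_neg]
  exact (absv_nonarch p _ _).trans (max_le hx (by rwa [(absv p L).map_neg]))

variable {p} in
lemma absv_sub_lt {x y : L} {r : ℝ} (hx : absv p L x < r) (hy : absv p L y < r) :
    absv p L (x - y) < r := by
  rw [sub_eq_add_neg]
  exact (absv_nonarch p _ _).trans_lt (max_lt hx (by rwa [(absv p L).map_neg]))

variable {p} in
lemma absv_add_eq_of_lt {x y : L} (h : absv p L y < absv p L x) :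
    absv p L (x + y) = absv p L x :=
  IsNonarchimedean.add_eq_left_of_lt (absv_nonarch p) h

lemma absv_natCast_self : absv p L (p : L) = (p : ℝ)⁻¹ := by
  have h := spectralNorm_extends (K := ℚ_[p]) (L := L) (p : ℚ_[p])
  rw [map_natCast] at h
  rw [absv_def, h, Padic.norm_p]

lemma absv_equiv {K : Type*} [Field K] [Algebra ℚ_[p] K] [Algebra K L] [IsScalarTower ℚ_[p] K L]
    (σ : Gal(L/K)) (x : L) : absv p L (σ x) = absv p L x :=
  (spectralNorm_eq_of_equiv (σ.restrictScalars ℚ_[p]) x).symm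

lemma absv_algebraMap {E : Type*} [Field E] [Algebra ℚ_[p] E] [Algebra.IsAlgebraic ℚ_[p] E]
    [Algebra E L] [IsScalarTower ℚ_[p] E L] (x : E) :
    absv p L (algebraMap E L x) = absv p E x :=
  (spectralNorm.eq_of_tower (K := ℚ_[p]) x).symm

lemma val_eq {x : L} (hx : x ≠ 0) :
    val p x = ((-Real.logb p (absv p L x) : ℝ) : EReal) := by
  rw [val, if_neg hx]; rfl

variable {p}

lemma absv_root {ξ : L} (h : ξ ^ p = 1) : absv p L ξ = 1 := by
  have h1 : absv p L ξ ^ p = 1 := by rw [← map_pow, h, map_one]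
  exact (pow_eq_one_iff_of_nonneg ((absv p L).nonneg _) (Fact.out : p.Prime).ne_zero).1 h1

variable (p) in
omit [Fact p.Prime] in
/-- The absolute value of `1 - ζ`, for a nontrivial `p`-th root of unity `ζ`. -/
noncomputable def lam : ℝ := (p : ℝ) ^ (-((p : ℝ) - 1)⁻¹)

lemma one_lt_natCast_prime : (1 : ℝ) < p := by
  exact_mod_cast (Fact.out : p.Prime).one_lt

lemma lam_pos : 0 < lam p :=
  Real.rpow_pos_of_pos (zero_lt_one.trans one_lt_natCast_prime) _

lemma lam_pow : lam p ^ (p - 1) = (p : ℝ)⁻¹ := by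
  have hp := one_lt_natCast_prime (p := p)
  rw [lam, ← Real.rpow_natCast, ← Real.rpow_mul (by linarith),
    Nat.cast_sub (Fact.out : p.Prime).one_le, Nat.cast_one, neg_mul,
    inv_mul_cancel₀ (by linarith), Real.rpow_neg_one]

lemma lam_lt_one : lam p < 1 := by
  have hp := one_lt_natCast_prime (p := p)
  exact Real.rpow_lt_one_of_one_lt_of_neg hp (by
    have : 0 < ((p : ℝ) - 1)⁻¹ := inv_pos.2 (by linarith)
    linarith)

lemma absv_geom_le {ζ : L} (hζ : ζ ^ p = 1) (k : ℕ) :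
    absv p L (1 - ζ ^ k) ≤ absv p L (1 - ζ) := by
  induction k with
  | zero => simp
  | succ k ih =>
    have : 1 - ζ ^ (k + 1) = (1 - ζ) - ζ * (ζ ^ k - 1) := by ring
    rw [this]
    refine absv_sub_le le_rfl ?_
    rwa [map_mul, absv_root hζ, one_mul, (absv p L).map_sub]

lemma absv_one_sub_root {ξ : L} (h : ξ ^ p = 1) (h1 : ξ ≠ 1) :
    absv p L (1 - ξ) = lam p := by
  have hp : p.Prime := Fact.out
  have hξ : IsPrimitiveRoot ξ p := by
    rw [IsPrimitiveRoot.iff_orderOf]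
    exact orderOf_eq_prime h h1
  have hprod : ∏ k ∈ Finset.range (p - 1), (1 - ξ ^ (k + 1)) = (p : L) := by
    have hξ' : IsPrimitiveRoot ξ (p - 1 + 1) := by rwa [Nat.sub_add_cancel hp.one_le]
    rw [hξ'.prod_one_sub_pow_eq_order, ← Nat.cast_add_one, Nat.sub_add_cancel hp.one_le]
  have heq : ∀ k ∈ Finset.range (p - 1), absv p L (1 - ξ ^ (k + 1)) = absv p L (1 - ξ) := by
    intro k hk
    refine le_antisymm (absv_geom_le h _) ?_
    have hk' : (k + 1).Coprime p := by
      rw [Nat.coprime_comm, hp.coprime_iff_not_dvd]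
      intro hd
      have := Nat.le_of_dvd (by omega) hd
      have := Finset.mem_range.1 hk
      omega
    -- `ξ` is a power of `ξ ^ (k + 1)`
    have hpr := hξ.pow_of_coprime _ hk'
    obtain ⟨i, -, hi⟩ := hpr.eq_pow_of_pow_eq_one h
    have h3 := absv_geom_le (p := p) hpr.pow_eq_one i
    rwa [hi] at h3
  have h2 : absv p L (1 - ξ) ^ (p - 1) = lam p ^ (p - 1) := by
    rw [lam_pow, ← absv_natCast_self p (L := L), ← hprod, map_prod, Finset.prod_congr rfl heq]
    simp
  exact (pow_left_inj₀ ((absv p L).nonneg _) lam_pos.le (by have := hp.two_le; omega)).1 h2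

/-! ### Comparing `p`-th roots -/

variable {ζ : L} (hζ : IsPrimitiveRoot ζ p)
include hζ

/-- If `N (z ^ p - w ^ p) < D ^ p`, some conjugate `ξ w` of `w` is closer than `D` to `z`. -/
lemma exists_root_near {z w : L} {D : ℝ} (hD : 0 < D)
    (h : absv p L (z ^ p - w ^ p) < D ^ p) :
    ∃ ξ : L, ξ ^ p = 1 ∧ absv p L (z - ξ * w) < D := by
  by_contra! hcon
  rw [hζ.pow_sub_pow_eq_prod_sub_mul _ _ (Fact.out : p.Prime).pos, map_prod] at h
  refine absurd h (not_lt.2 ?_)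
  calc D ^ p = ∏ _ξ ∈ Polynomial.nthRootsFinset p (1 : L), D := by
        rw [Finset.prod_const, hζ.card_nthRootsFinset]
    _ ≤ _ := Finset.prod_le_prod (fun _ _ => hD.le) fun ξ hξ => hcon ξ
        ((Polynomial.mem_nthRootsFinset (Fact.out : p.Prime).pos _).1 hξ)

omit hζ in
lemma absv_sub_root_mul_le {ξ w : L} (hξ : ξ ^ p = 1) :
    absv p L (w - ξ * w) ≤ lam p * absv p L w := by
  have : w - ξ * w = (1 - ξ) * w := by ring
  rw [this, map_mul]
  refine mul_le_mul_of_nonneg_right ?_ ((absv p L).nonneg _)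
  by_cases h1 : ξ = 1
  · simpa [h1] using lam_pos.le
  · exact (absv_one_sub_root hξ h1).le

/-- If `N (z ^ p - w ^ p) ≤ S ^ p`, and `S` is at least the distance between conjugates,
then `N (z - w) ≤ S`. -/
lemma absv_sub_le_of_pow {z w : L} {S : ℝ} (hS : 0 < S) (hw : lam p * absv p L w ≤ S)
    (h : absv p L (z ^ p - w ^ p) ≤ S ^ p) : absv p L (z - w) ≤ S := by
  refine le_of_forall_gt_imp_ge_of_dense fun T hT => ?_
  obtain ⟨ξ, hξ, h1⟩ := exists_root_near hζ (hS.trans hT)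
    (h.trans_lt (pow_lt_pow_left₀ hT hS.le (Fact.out : p.Prime).ne_zero))
  have h2 : z - w = (z - ξ * w) - (w - ξ * w) := by ring
  rw [h2]
  exact absv_sub_le h1.le ((absv_sub_root_mul_le hξ).trans (hw.trans hT.le))

/-- If `N (z ^ p - w ^ p) = S ^ p`, and `S` is larger than the distance between conjugates,
then `N (z - w) = S`. -/
lemma absv_sub_eq_of_pow {z w : L} {S : ℝ} (hS : 0 < S) (hw : lam p * absv p L w < S)
    (h : absv p L (z ^ p - w ^ p) = S ^ p) : absv p L (z - w) = S := by
  refine (absv_sub_le_of_pow hζ hS hw.le h.le).eq_of_not_lt fun hlt => ?_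
  set T := max (absv p L (z - w)) (lam p * absv p L w)
  have hTS : T < S := max_lt hlt hw
  have hT0 : 0 ≤ T := le_max_of_le_left ((absv p L).nonneg _)
  refine absurd h (ne_of_lt ?_)
  rw [hζ.pow_sub_pow_eq_prod_sub_mul _ _ (Fact.out : p.Prime).pos, map_prod]
  calc _ ≤ ∏ _ξ ∈ Polynomial.nthRootsFinset p (1 : L), T := by
        refine Finset.prod_le_prod (fun _ _ => (absv p L).nonneg _) fun ξ hξ => ?_
        have hξ' := (Polynomial.mem_nthRootsFinset (Fact.out : p.Prime).pos _).1 hξ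
        have h2 : z - ξ * w = (z - w) - (ξ * w - w) := by ring
        rw [h2]
        refine absv_sub_le (le_max_left _ _) ?_
        rw [(absv p L).map_sub]
        exact (absv_sub_root_mul_le hξ').trans (le_max_right _ _)
    _ = T ^ p := by rw [Finset.prod_const, hζ.card_nthRootsFinset]
    _ < S ^ p := pow_lt_pow_left₀ hTS hT0 (Fact.out : p.Prime).ne_zero

omit hζ in
/-- Two conjugates `ξ w`, `ξ' w` that are closer than `lam p * N w` coincide. -/
lemma root_eq_of_absv_lt {ξ ξ' w : L} (hξ : ξ ^ p = 1) (hξ' : ξ' ^ p = 1)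
    (h : absv p L (ξ * w - ξ' * w) < lam p * absv p L w) : ξ = ξ' := by
  by_contra hne
  have h0 : ξ ≠ 0 := by
    rintro rfl; simp [(Fact.out : p.Prime).ne_zero] at hξ
  have h1 : ξ * w - ξ' * w = ξ * ((1 - ξ' / ξ) * w) := by field_simp
  rw [h1, map_mul, map_mul, absv_root hξ, one_mul, absv_one_sub_root
    (by rw [div_pow, hξ, hξ', div_one])
    (by rw [Ne, div_eq_one_iff_eq h0]; exact Ne.symm hne)] at h
  exact lt_irrefl _ h

end AbsoluteValue

/-! ### Branches of the tree of preimages -/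

section Branch

variable {p : ℕ} [Fact p.Prime]

/-- A sequence `z` with `z (i + 1) ^ p = c + z i`, that is `f (z (i + 1)) = z i` for
`f (z) = z ^ p - c`, where `N c = ρ ^ p` and `N (z 0) ≤ ρ` for a real number `ρ` such that
`lam p * ρ`, the common distance between distinct `p`-th roots of absolute value `ρ`,
is larger than `1`. -/
structure IsBranch {L : Type*} [Field L] [Algebra ℚ_[p] L] [Algebra.IsAlgebraic ℚ_[p] L]
    (c : L) (ρ : ℝ) (z : ℕ → L) : Prop where
  pow_succ : ∀ i, z (i + 1) ^ p = c + z i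
  absv_c : absv p L c = ρ ^ p
  one_lt : 1 < lam p * ρ
  absv_zero : absv p L (z 0) ≤ ρ

section

variable {L : Type*} [Field L] [Algebra ℚ_[p] L] [Algebra.IsAlgebraic ℚ_[p] L]

lemma one_lt_of_lam_mul {ρ : ℝ} (h : 1 < lam p * ρ) : 1 < ρ := by
  have h1 := lam_pos (p := p)
  have h2 := lam_lt_one (p := p)
  nlinarith

lemma lt_pow_prime {x : ℝ} (h : 1 < x) : x < x ^ p :=
  lt_self_pow₀ h (Fact.out : p.Prime).one_lt

lemma absv_of_pow_eq {c z w : L} {ρ : ℝ} (hc : absv p L c = ρ ^ p) (hρ : 1 < ρ)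
    (hw : absv p L w ≤ ρ) (hz : z ^ p = c + w) : absv p L z = ρ := by
  have h : absv p L z ^ p = ρ ^ p := by
    rw [← map_pow, hz, absv_add_eq_of_lt, hc]
    rw [hc]
    exact hw.trans_lt (lt_pow_prime hρ)
  exact (pow_left_inj₀ ((absv p L).nonneg _) (by linarith) (Fact.out : p.Prime).ne_zero).1 h

omit [Algebra ℚ_[p] L] [Algebra.IsAlgebraic ℚ_[p] L] in
lemma exists_root_of_pow_eq {x y : L} (h : x ^ p = y ^ p) :
    ∃ ξ : L, ξ ^ p = 1 ∧ x = ξ * y := by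
  by_cases hy : y = 0
  · refine ⟨1, one_pow _, ?_⟩
    rw [hy, zero_pow (Fact.out : p.Prime).ne_zero] at h
    rw [hy, mul_zero]
    exact pow_eq_zero_iff (Fact.out : p.Prime).ne_zero |>.1 h
  · exact ⟨x / y, by rw [div_pow, h, div_self (pow_ne_zero _ hy)], by field_simp⟩

namespace IsBranch

variable {c : L} {ρ : ℝ} {z : ℕ → L} (hz : IsBranch (p := p) c ρ z)
include hz

lemma one_lt_rho : 1 < ρ := one_lt_of_lam_mul hz.one_lt

lemma absv_le (i : ℕ) : absv p L (z i) ≤ ρ := by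
  induction i with
  | zero => exact hz.absv_zero
  | succ i ih => exact (absv_of_pow_eq hz.absv_c hz.one_lt_rho ih (hz.pow_succ i)).le

lemma absv_succ (i : ℕ) : absv p L (z (i + 1)) = ρ :=
  absv_of_pow_eq hz.absv_c hz.one_lt_rho (hz.absv_le i) (hz.pow_succ i)

variable {ζ : L} (hζ : IsPrimitiveRoot ζ p)
include hζ

/-- Once two consecutive terms are at distance at most `(lam p * ρ) ^ p`,
the following ones are at distance at most `lam p * ρ`. -/
lemma absv_sub_succ_le {i : ℕ} (h : absv p L (z (i + 1) - z i) ≤ (lam p * ρ) ^ p) :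
    absv p L (z (i + 2) - z (i + 1)) ≤ lam p * ρ := by
  refine absv_sub_le_of_pow hζ (by linarith [hz.one_lt]) (by rw [hz.absv_succ]) ?_
  rwa [hz.pow_succ, hz.pow_succ, add_sub_add_left_eq_sub]

lemma absv_sub_le_of_le {n : ℕ} (h : absv p L (z (n + 1) - z n) ≤ (lam p * ρ) ^ p) (j : ℕ) :
    absv p L (z (n + 1 + j + 1) - z (n + 1 + j)) ≤ lam p * ρ := by
  induction j with
  | zero => exact hz.absv_sub_succ_le hζ h
  | succ j ih => exact hz.absv_sub_succ_le hζ (ih.trans (lt_pow_prime hz.one_lt).le)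

/-- As long as the distance between consecutive terms is large, it goes down by `p`-th roots.
For `n = 0` there is no step, so `R` need not exceed `lam p * ρ`. -/
lemma absv_sub_eq {n : ℕ} {R : ℝ} (hR : 1 < R) (hRn : R ^ p ^ n = ρ)
    (hD : 0 < n → lam p * ρ < R) (h0 : absv p L (z 0) < ρ) {i : ℕ} (hi : i ≤ n) :
    absv p L (z (i + 1) - z i) = R ^ p ^ (n - i) := by
  induction i with
  | zero =>
    rw [sub_eq_add_neg, absv_add_eq_of_lt, hz.absv_succ, Nat.sub_zero, hRn]
    rwa [(absv p L).map_neg, hz.absv_succ]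
  | succ i ih =>
    refine absv_sub_eq_of_pow hζ (by positivity) ?_ ?_
    · rw [hz.absv_succ]
      exact (hD (by omega)).trans_le (le_self_pow₀ hR.le
        (pow_ne_zero _ (Fact.out : p.Prime).ne_zero))
    · rw [hz.pow_succ, hz.pow_succ, add_sub_add_left_eq_sub, ih (by omega), ← pow_mul,
        ← _root_.pow_succ]
      congr 2
      omega

/-- The variant of `absv_sub_eq` with upper bounds, where `z 0` may have absolute value `ρ`. -/
lemma absv_sub_le_pow {n : ℕ} {R : ℝ} (hR : 1 < R) (hRn : R ^ p ^ n = ρ)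
    (hD : lam p * ρ ≤ R) {i : ℕ} (hi : i ≤ n) :
    absv p L (z (i + 1) - z i) ≤ R ^ p ^ (n - i) := by
  induction i with
  | zero =>
    rw [Nat.sub_zero, hRn]
    exact absv_sub_le (hz.absv_succ 0).le hz.absv_zero
  | succ i ih =>
    refine absv_sub_le_of_pow hζ (by positivity) ?_ ?_
    · rw [hz.absv_succ]
      exact hD.trans (le_self_pow₀ hR.le (pow_ne_zero _ (Fact.out : p.Prime).ne_zero))
    · rw [hz.pow_succ, hz.pow_succ, add_sub_add_left_eq_sub, ← pow_mul, ← _root_.pow_succ,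
        show n - (i + 1) + 1 = n - i by omega]
      exact ih (by omega)

end IsBranch

end

/-! ### Galois action on branches -/

section Galois

variable {K : Type*} [Field K] [Algebra ℚ_[p] K] {Ω : Type*} [Field Ω] [Algebra K Ω]
  [Algebra ℚ_[p] Ω] [IsScalarTower ℚ_[p] K Ω] [Algebra.IsAlgebraic ℚ_[p] Ω]

omit [Algebra ℚ_[p] K] [Algebra ℚ_[p] Ω] [IsScalarTower ℚ_[p] K Ω]
  [Algebra.IsAlgebraic ℚ_[p] Ω] in
lemma exists_rootsOfUnity {ζ : K} (hζ : IsPrimitiveRoot ζ p) {ξ : Ω} (h : ξ ^ p = 1) :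
    ∃ ξ' : rootsOfUnity p K, algebraMap K Ω ((ξ' : Kˣ) : K) = ξ := by
  obtain ⟨k, -, hk⟩ := (hζ.map_of_injective (algebraMap K Ω).injective).eq_pow_of_pow_eq_one h
  refine ⟨rootsOfUnity.mkOfPowEq (ζ ^ k) (by rw [← pow_mul, mul_comm, pow_mul, hζ.pow_eq_one,
    one_pow]), ?_⟩
  rw [rootsOfUnity.val_mkOfPowEq_coe, map_pow, hk]

omit [Fact p.Prime] [Algebra ℚ_[p] K] [Algebra ℚ_[p] Ω] [IsScalarTower ℚ_[p] K Ω]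
  [Algebra.IsAlgebraic ℚ_[p] Ω] in
lemma rootsOfUnity_pow (ξ : rootsOfUnity p K) :
    (algebraMap K Ω ((ξ : Kˣ) : K)) ^ p = 1 := by
  rw [← map_pow, (mem_rootsOfUnity' p (ξ : Kˣ)).1 ξ.2, map_one]

variable {ζ : K} (hζ : IsPrimitiveRoot ζ p)
include hζ

/-- Krasner's lemma for `p`-th roots: if `w` is sufficiently close to `w'`, then a `p`-th root of
`c + w'` is fixed by every automorphism that fixes `w'` and a `p`-th root of `c + w`. -/
lemma fixed_of_near {c : Ω} {ρ : ℝ} {u w y w' : Ω} (hD : 0 < lam p * ρ) (hu : u ^ p = c + w)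
    (hy : y ^ p = c + w') (hyρ : absv p Ω y = ρ) (h : absv p Ω (w' - w) < (lam p * ρ) ^ p)
    {σ : Gal(Ω/K)} (hσc : σ c = c) (hσu : σ u = u) (hσw : σ w' = w') : σ y = y := by
  obtain ⟨ξ, hξ, h1⟩ := exists_root_near (hζ.map_of_injective (algebraMap K Ω).injective)
    (z := y) (w := u) hD (by rwa [hu, hy, add_sub_add_left_eq_sub])
  obtain ⟨ξ', rfl⟩ := exists_rootsOfUnity hζ hξ
  have h2 : absv p Ω (σ y - algebraMap K Ω ((ξ' : Kˣ) : K) * u) < lam p * ρ := by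
    rw [← absv_equiv p σ, map_sub, map_mul, hσu, AlgEquiv.commutes] at h1
    exact h1
  have h3 : (σ y) ^ p = y ^ p := by rw [← map_pow, hy, map_add, hσc, hσw]
  obtain ⟨ξ, hξ, h4⟩ := exists_root_of_pow_eq h3
  have h5 : ξ = 1 := by
    refine root_eq_of_absv_lt (w := y) hξ (one_pow _) ?_
    rw [hyρ, one_mul, ← h4]
    have := absv_sub_lt h2 h1
    rwa [sub_sub_sub_cancel_right] at this
  rw [h4, h5, one_mul]

namespace IsBranch

variable {c a : K} {ρ : ℝ} {z : ℕ → Ω} (hz : IsBranch (p := p) (algebraMap K Ω c) ρ z)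
  (h0 : z 0 = algebraMap K Ω a)
include hz h0

omit [Algebra ℚ_[p] K] [IsScalarTower ℚ_[p] K Ω] in
/-- Every point of the tree is close to the point of a branch at the same level. -/
lemma absv_preimage_sub_le {m : ℕ} {α : Ω} (hα : α ∈ preimages Ω p c a m) :
    absv p Ω α ≤ ρ ∧ absv p Ω (α - z m) ≤ lam p * ρ := by
  have hpos : 0 < lam p * ρ := zero_lt_one.trans hz.one_lt
  induction m generalizing α with
  | zero =>
    have : α = z 0 := by rw [h0]; exact hα
    rw [this, sub_self, map_zero]
    exact ⟨hz.absv_zero, hpos.le⟩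
  | succ m ih =>
    have h1 := ih (α := α ^ p - algebraMap K Ω c) hα
    refine ⟨(absv_of_pow_eq hz.absv_c hz.one_lt_rho h1.1 (by ring)).le, ?_⟩
    refine absv_sub_le_of_pow (hζ.map_of_injective (algebraMap K Ω).injective) hpos
      (by rw [hz.absv_succ]) ?_
    rw [hz.pow_succ, ← sub_sub]
    exact h1.2.trans (lt_pow_prime hz.one_lt).le

/-- An automorphism that fixes one branch up to level `m` fixes all points of level `m`. -/
lemma fixed_preimage {m : ℕ} {σ : Gal(Ω/K)} (hσ : ∀ i ≤ m, σ (z i) = z i) {α : Ω}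
    (hα : α ∈ preimages Ω p c a m) : σ α = α := by
  have hpos : 0 < lam p * ρ := zero_lt_one.trans hz.one_lt
  induction m generalizing α with
  | zero =>
    have : α = z 0 := by rw [h0]; exact hα
    rw [this, hσ 0 le_rfl]
  | succ m ih =>
    have hα' : α ^ p - algebraMap K Ω c ∈ preimages Ω p c a m := hα
    have h1 := hz.absv_preimage_sub_le hζ h0 hα'
    have h2 := absv_of_pow_eq (z := α) hz.absv_c hz.one_lt_rho h1.1 (by ring)
    exact fixed_of_near hζ hpos (hz.pow_succ m) (by ring) h2
      (h1.2.trans_lt (lt_pow_prime hz.one_lt)) (σ.commutes c) (hσ _ le_rfl)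
      (ih (fun i hi => hσ i (by omega)) hα')

omit h0 in
/-- If `z n` and `z (n + 1)` are sufficiently close, the whole branch is defined over
`K(z (n + 1))`. -/
lemma fixed_of_fixed {n : ℕ} (h : absv p Ω (z (n + 1) - z n) < (lam p * ρ) ^ p) {σ : Gal(Ω/K)}
    (hσ : σ (z (n + 1)) = z (n + 1)) (j : ℕ) : σ (z (n + 1 + j)) = z (n + 1 + j) := by
  have hpos : 0 < lam p * ρ := zero_lt_one.trans hz.one_lt
  have hζ' := hζ.map_of_injective (algebraMap K Ω).injective
  induction j with
  | zero => exact hσ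
  | succ j ih =>
    refine fixed_of_near hζ hpos (u := z (n + 1 + j)) (w := z (n + j)) (w' := z (n + 1 + j))
      ?_ (hz.pow_succ _) (hz.absv_succ _) ?_ (σ.commutes c) ih ih
    · rw [← hz.pow_succ, show n + j + 1 = n + 1 + j by omega]
    · cases j with
      | zero => exact h
      | succ j =>
        have := hz.absv_sub_le_of_le hζ' h.le j
        rw [show n + 1 + j + 1 = n + 1 + (j + 1) by omega,
          show n + 1 + j = n + (j + 1) by omega] at this
        exact this.trans_lt (lt_pow_prime hz.one_lt)

omit [Algebra ℚ_[p] K] [IsScalarTower ℚ_[p] K Ω] hζ in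
/-- Galois conjugates of a branch are branches. -/
lemma map_equiv (σ : Gal(Ω/K)) :
    IsBranch (p := p) (algebraMap K Ω c) ρ (fun i => σ (z i)) where
  pow_succ i := by rw [← map_pow, hz.pow_succ, map_add, σ.commutes]
  absv_c := hz.absv_c
  one_lt := hz.one_lt
  absv_zero := by rw [h0, σ.commutes, ← h0]; exact hz.absv_zero

omit [Algebra ℚ_[p] K] [IsScalarTower ℚ_[p] K Ω] hζ in
lemma mem_preimages (m : ℕ) : z m ∈ preimages Ω p c a m := by
  induction m with
  | zero => exact h0
  | succ m ih =>
    change (fun z : Ω => z ^ p - algebraMap K Ω c)^[m] (z (m + 1) ^ p - algebraMap K Ω c) = _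
    rw [hz.pow_succ, add_sub_cancel_left]
    exact ih

omit [Algebra ℚ_[p] K] [IsScalarTower ℚ_[p] K Ω] in
/-- The root of unity by which an automorphism approximately multiplies `z (i + 1)`. -/
lemma exists_chi (i : ℕ) (σ : Gal(Ω/K)) : ∃ ξ : rootsOfUnity p K,
    absv p Ω (σ (z (i + 1)) - algebraMap K Ω ((ξ : Kˣ) : K) * z (i + 1)) < lam p * ρ := by
  have h1 := (hz.absv_preimage_sub_le hζ h0 ((hz.map_equiv h0 σ).mem_preimages
    (by rw [h0, σ.commutes]) i)).2
  obtain ⟨ξ, hξ, h2⟩ := exists_root_near (hζ.map_of_injective (algebraMap K Ω).injective)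
    (z := σ (z (i + 1))) (w := z (i + 1)) (D := lam p * ρ) (zero_lt_one.trans hz.one_lt) (by
      rw [← map_pow, hz.pow_succ, map_add, σ.commutes, add_sub_add_left_eq_sub]
      exact h1.trans_lt (lt_pow_prime hz.one_lt))
  obtain ⟨ξ', rfl⟩ := exists_rootsOfUnity hζ hξ
  exact ⟨ξ', h2⟩

omit [Algebra ℚ_[p] K] [IsScalarTower ℚ_[p] K Ω] hζ h0 in
lemma chi_unique {i : ℕ} {x : Ω} {ξ ξ' : rootsOfUnity p K}
    (h : absv p Ω (x - algebraMap K Ω ((ξ : Kˣ) : K) * z (i + 1)) < lam p * ρ)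
    (h' : absv p Ω (x - algebraMap K Ω ((ξ' : Kˣ) : K) * z (i + 1)) < lam p * ρ) : ξ = ξ' := by
  have := absv_sub_lt h' h
  rw [sub_sub_sub_cancel_left, ← hz.absv_succ i] at this
  have := root_eq_of_absv_lt (rootsOfUnity_pow ξ) (rootsOfUnity_pow ξ') this
  exact Subtype.ext (Units.ext ((algebraMap K Ω).injective this))

/-- The character of the Galois group that sends `σ` to the root of unity `ξ` such that `σ` is
approximately multiplication by `ξ` at `z (i + 1)`. -/
noncomputable def chi (i : ℕ) : Gal(Ω/K) →* rootsOfUnity p K :=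
  MonoidHom.mk' (fun σ => (hz.exists_chi hζ h0 i σ).choose) fun σ τ => by
    refine hz.chi_unique (hz.exists_chi hζ h0 i (σ * τ)).choose_spec ?_
    have h1 := (hz.exists_chi hζ h0 i σ).choose_spec
    have h2 := (hz.exists_chi hζ h0 i τ).choose_spec
    set ξ := (hz.exists_chi hζ h0 i σ).choose
    set ξ' := (hz.exists_chi hζ h0 i τ).choose
    rw [← absv_equiv p σ] at h2
    rw [← one_mul (absv p Ω (σ _ - _)), ← absv_root (rootsOfUnity_pow (Ω := Ω) ξ'),
      ← map_mul] at h1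
    refine lt_of_eq_of_lt ?_ ((absv_nonarch p _ _).trans_lt (max_lt h1 h2))
    congr 1
    rw [map_sub, map_mul, σ.commutes]
    simp only [AlgEquiv.mul_apply, Subgroup.coe_mul, Units.val_mul, map_mul]
    ring

lemma chi_spec (i : ℕ) (σ : Gal(Ω/K)) :
    absv p Ω (σ (z (i + 1)) -
      algebraMap K Ω ((hz.chi hζ h0 i σ : Kˣ) : K) * z (i + 1)) < lam p * ρ :=
  (hz.exists_chi hζ h0 i σ).choose_spec

lemma chi_eq_one_of_fixed {i : ℕ} {σ : Gal(Ω/K)} (h : σ (z (i + 1)) = z (i + 1)) :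
    hz.chi hζ h0 i σ = 1 := by
  refine hz.chi_unique (hz.chi_spec hζ h0 i σ) ?_
  simpa [h] using zero_lt_one.trans hz.one_lt

/-- The common kernel of the first `m` characters fixes the branch up to level `m`. -/
lemma fixed_of_chi {m : ℕ} {σ : Gal(Ω/K)} (h : ∀ i < m, hz.chi hζ h0 i σ = 1) :
    ∀ i ≤ m, σ (z i) = z i := by
  intro i hi
  induction i with
  | zero => rw [h0, σ.commutes]
  | succ i ih =>
    have h1 : (σ (z (i + 1))) ^ p = z (i + 1) ^ p := by
      rw [← map_pow, hz.pow_succ, map_add, σ.commutes, ih (by omega)]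
    obtain ⟨ξ, hξ, h2⟩ := exists_root_of_pow_eq h1
    have h3 := hz.chi_spec hζ h0 i σ
    rw [h i (by omega), h2, ← hz.absv_succ i] at h3
    have h4 : ξ = 1 := root_eq_of_absv_lt hξ (one_pow _) (w := z (i + 1)) (by simpa using h3)
    rw [h2, h4, one_mul]

end IsBranch

end Galois

end Branch

/-! ### Residue fields and inertia groups -/

section Residue

open IsLocalRing

variable (p : ℕ) [Fact p.Prime]

section

variable {L : Type*} [Field L] [Algebra ℚ_[p] L] [Algebra.IsAlgebraic ℚ_[p] L]

lemma mem_valRing {x : L} : x ∈ valRing p L ↔ absv p L x ≤ 1 := val_nonneg_iff p x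

variable {p}

lemma residue_eq_zero_iff_absv_lt (b : valRing p L) :
    residue (valRing p L) b = 0 ↔ absv p L b < 1 := by
  rw [residue_eq_zero_iff, mem_maximalIdeal, mem_nonunits_iff, ← not_iff_not, not_not, not_lt]
  constructor
  · rintro ⟨u, rfl⟩
    have h1 : absv p L ((u : valRing p L) : L) * absv p L ((u⁻¹ : (valRing p L)ˣ) : valRing p L)
        = 1 := by
      rw [← map_mul, ← (absv p L).map_one, ← OneMemClass.coe_one (valRing p L), ← u.mul_inv]
      rfl
    have h2 := (mem_valRing p).1 ((u⁻¹ : (valRing p L)ˣ) : valRing p L).2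
    have h3 := (absv p L).nonneg ((u : valRing p L) : L)
    nlinarith
  · intro h
    have h0 : (b : L) ≠ 0 := by
      rw [← (absv p L).pos_iff]; linarith
    refine IsUnit.of_mul_eq_one ⟨(b : L)⁻¹, (mem_valRing p).2 ?_⟩ (Subtype.ext (mul_inv_cancel₀ h0))
    rw [map_inv₀]
    exact inv_le_one_of_one_le₀ h

lemma residue_eq_iff_absv_lt (b b' : valRing p L) :
    residue (valRing p L) b = residue (valRing p L) b' ↔ absv p L (b - b' : L) < 1 := by
  rw [← sub_eq_zero, ← map_sub, residue_eq_zero_iff_absv_lt]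
  rfl

instance charP_residueField : CharP (ResidueField (valRing p L)) p := by
  rw [CharP.charP_iff_prime_eq_zero Fact.out, ← map_natCast (residue (valRing p L)),
    residue_eq_zero_iff_absv_lt]
  change absv p L (p : L) < 1
  rw [absv_natCast_self]
  exact inv_lt_one_of_one_lt₀ one_lt_natCast_prime

/-- Lifts of elements of the residue field that are independent over `F_p` are independent over
`ℚ_p`, so the residue field of a finite extension of `ℚ_p` is finite. -/
lemma finite_residueField [FiniteDimensional ℚ_[p] L] : Finite (ResidueField (valRing p L)) := by
  let _ : Algebra (ZMod p) (ResidueField (valRing p L)) := ZMod.algebra _ p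
  have hrank : ∀ s : Finset (ResidueField (valRing p L)),
      LinearIndependent (ZMod p) (fun i : s => (i : ResidueField (valRing p L))) →
      s.card ≤ Module.finrank ℚ_[p] L := by
    intro s hs
    choose g hg using residue_surjective (R := valRing p L)
    have hli : LinearIndependent ℚ_[p] (fun i : s => (g i : L)) := by
      rw [Fintype.linearIndependent_iff]
      intro f hf
      by_contra! hne
      obtain ⟨i₀, hi₀⟩ := hne
      obtain ⟨j, -, hj⟩ := Finset.exists_max_image Finset.univ (fun i : s => ‖f i‖)
        ⟨i₀, Finset.mem_univ _⟩
      have hfj : f j ≠ 0 := by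
        intro h0
        have := hj i₀ (Finset.mem_univ _)
        rw [h0, norm_zero] at this
        exact hi₀ (norm_le_zero_iff.1 this)
      -- after scaling, the coefficients are `p`-adic integers and one of them is `1`
      have hint : ∀ i, ‖f i / f j‖ ≤ 1 := fun i => by
        rw [norm_div]
        exact div_le_one_of_le₀ (hj i (Finset.mem_univ _)) (norm_nonneg _)
      let e : s → ℤ_[p] := fun i => ⟨f i / f j, hint i⟩
      have hred : ∀ x : ℤ_[p], ∃ y : valRing p L, (y : L) = algebraMap ℚ_[p] L x ∧
          residue _ y = algebraMap (ZMod p) _ (PadicInt.toZMod x) := by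
        intro x
        have hx : absv p L (algebraMap ℚ_[p] L x) ≤ 1 := by
          rw [absv_def, spectralNorm_extends]; exact x.2
        refine ⟨⟨_, (mem_valRing p).2 hx⟩, rfl, ?_⟩
        obtain ⟨n, hn⟩ : ∃ n : ℕ, PadicInt.toZMod x = n := ⟨_, (ZMod.natCast_zmod_val _).symm⟩
        rw [hn, map_natCast, ← map_natCast (residue (valRing p L)), residue_eq_iff_absv_lt]
        have h1 : x - n ∈ maximalIdeal ℤ_[p] := by
          rw [← PadicInt.ker_toZMod, RingHom.mem_ker, map_sub, hn, map_natCast, sub_self]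
        have h2 : ((n : valRing p L) : L) = algebraMap ℚ_[p] L (n : ℚ_[p]) := by
          rw [map_natCast]; rfl
        change absv p L (algebraMap ℚ_[p] L x - ((n : valRing p L) : L)) < 1
        rw [h2, ← map_sub, absv_def, spectralNorm_extends]
        have h3 := PadicInt.mem_nonunits.1 ((mem_maximalIdeal _).1 h1)
        simpa [PadicInt.norm_def] using h3
      choose y hy1 hy2 using hred
      have hsum : ∑ i, y (e i) * g i = 0 := by
        apply Subtype.ext
        have h1 : ∑ i, (algebraMap ℚ_[p] L (f i / f j)) * (g i : L) = 0 := by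
          have := congrArg (fun x => algebraMap ℚ_[p] L (f j)⁻¹ * x) hf
          simp only [mul_zero, Finset.mul_sum, Algebra.smul_def] at this
          rw [← this]
          refine Finset.sum_congr rfl fun i _ => ?_
          rw [div_eq_mul_inv, map_mul]
          ring
        rw [ZeroMemClass.coe_zero, ← h1, AddSubmonoidClass.coe_finsetSum]
        exact Finset.sum_congr rfl fun i _ => by rw [MulMemClass.coe_mul, hy1]
      have hsum' := congrArg (residue (valRing p L)) hsum
      simp only [map_sum, map_mul, map_zero, hy2, hg] at hsum'
      have := Fintype.linearIndependent_iff.1 hs (fun i => PadicInt.toZMod (e i))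
        (by simpa only [Algebra.smul_def] using hsum') j
      have he : e j = 1 := Subtype.ext (div_self hfj)
      rw [he, map_one] at this
      exact one_ne_zero this
    simpa using hli.fintype_card_le_finrank
  have h1 : Module.rank (ZMod p) (ResidueField (valRing p L)) < Cardinal.aleph0 :=
    (rank_le hrank).trans_lt (Cardinal.natCast_lt_aleph0)
  have : Module.Finite (ZMod p) (ResidueField (valRing p L)) :=
    Module.rank_lt_aleph0_iff.1 h1
  exact Module.finite_of_finite (ZMod p)

end

variable {p}
variable {K L : Type*} [Field K] [Algebra ℚ_[p] K] [Field L] [Algebra ℚ_[p] L]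
  [Algebra.IsAlgebraic ℚ_[p] L] [Algebra K L] [IsScalarTower ℚ_[p] K L]

variable (p K L) in
/-- The action of the Galois group on the residue field. -/
noncomputable def residueAction : Gal(L/K) →* RingAut (ResidueField (valRing p L)) :=
  (MulSemiringAction.toRingAut ((valRing p L).decompositionSubgroup K)
    (ResidueField (valRing p L))).comp
    ((MonoidHom.id _).codRestrict _ fun σ => by
      rw [decompositionSubgroup_eq_top]; exact Subgroup.mem_top _)

lemma ker_residueAction : (residueAction p K L).ker = inertia p K L := by
  ext σ
  rw [inertia, Subgroup.mem_map]
  constructor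
  · intro h
    exact ⟨⟨σ, by rw [decompositionSubgroup_eq_top]; exact Subgroup.mem_top _⟩, h, rfl⟩
  · rintro ⟨τ, h, rfl⟩
    exact h

lemma absv_map_le (σ : Gal(L/K)) (b : valRing p L) : absv p L (σ b) ≤ 1 := by
  rw [absv_equiv]
  exact (mem_valRing p).1 b.2

variable (p) in
/-- The composition of a Galois automorphism with the reduction to the residue field. -/
noncomputable def red (σ : Gal(L/K)) : valRing p L →+* ResidueField (valRing p L) :=
  (residueAction p K L σ : ResidueField (valRing p L) →+* ResidueField (valRing p L)).comp
    (residue (valRing p L))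

lemma red_apply (σ : Gal(L/K)) (b : valRing p L) :
    red p σ b = residue (valRing p L) ⟨σ b, (mem_valRing p).2 (absv_map_le σ b)⟩ := rfl

lemma red_eq_iff {σ τ : Gal(L/K)} : red p σ = red p τ ↔ σ⁻¹ * τ ∈ inertia p K L := by
  rw [← ker_residueAction, MonoidHom.mem_ker, map_mul, map_inv, inv_mul_eq_one]
  constructor
  · intro h
    ext x
    obtain ⟨b, rfl⟩ := residue_surjective x
    exact RingHom.congr_fun h b
  · intro h
    rw [red, red, h]

lemma mem_inertia_iff {σ : Gal(L/K)} :
    σ ∈ inertia p K L ↔ ∀ x : L, absv p L x ≤ 1 → absv p L (σ x - x) < 1 := by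
  rw [← one_mul σ, ← inv_one, ← red_eq_iff, inv_one, one_mul, eq_comm]
  constructor
  · intro h x hx
    have := RingHom.congr_fun h ⟨x, (mem_valRing p).2 hx⟩
    rwa [red_apply, red_apply, residue_eq_iff_absv_lt] at this
  · intro h
    ext b
    rw [red_apply, red_apply, residue_eq_iff_absv_lt]
    exact h b ((mem_valRing p).1 b.2)

/-- If the Galois group has exponent `p`, its quotient by the inertia group, which acts faithfully
on a finite field and therefore is cyclic, embeds into `ℤ/pℤ`. -/
lemma exists_quotient_inertia_injective [FiniteDimensional ℚ_[p] L]
    (hexp : ∀ σ : Gal(L/K), σ ^ p = 1) :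
    ∃ φ : Gal(L/K) ⧸ inertia p K L →* Multiplicative (ZMod p), Function.Injective φ := by
  have := finite_residueField (p := p) (L := L)
  let _ : Algebra (ZMod p) (ResidueField (valRing p L)) := ZMod.algebra _ p
  let toAut : Gal(ResidueField (valRing p L)/ZMod p) →* RingAut (ResidueField (valRing p L)) :=
    MulSemiringAction.toRingAut _ _
  have hsurj : Function.Surjective toAut := fun f =>
    ⟨AlgEquiv.ofRingEquiv (f := f) fun r => RingHom.congr_fun
      (Subsingleton.elim ((f : ResidueField (valRing p L) →+* ResidueField (valRing p L)).comp
        (algebraMap (ZMod p) (ResidueField (valRing p L)))) (algebraMap (ZMod p) _)) r, rfl⟩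
  have hcyc := isCyclic_of_surjective toAut hsurj
  have hQ : IsCyclic (Gal(L/K) ⧸ inertia p K L) := by
    refine isCyclic_of_injective (QuotientGroup.lift (inertia p K L) (residueAction p K L)
      ker_residueAction.ge) ?_
    rw [← MonoidHom.ker_eq_bot_iff, QuotientGroup.ker_lift, ker_residueAction,
      QuotientGroup.map_mk'_self]
  obtain ⟨g, hg⟩ := hQ.exists_generator
  have hgp : g ^ p = 1 := by
    obtain ⟨σ, rfl⟩ := QuotientGroup.mk_surjective g
    rw [← QuotientGroup.mk_pow, hexp, QuotientGroup.mk_one]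
  have hcard := orderOf_eq_card_of_forall_mem_zpowers hg
  rcases (Nat.dvd_prime (Fact.out : p.Prime)).1 (orderOf_dvd_of_pow_eq_one hgp) with h | h
  · rw [orderOf_eq_one_iff] at h
    refine ⟨1, fun x y _ => ?_⟩
    have h1 := hg x
    have h2 := hg y
    rw [h, Subgroup.zpowers_one_eq_bot, Subgroup.mem_bot] at h1 h2
    rw [h1, h2]
  · exact ⟨(mulEquivOfPrimeCardEq (p := p) (hcard.symm.trans h)
      (by simp)).toMonoidHom, MulEquiv.injective _⟩

end Residue

/-! ### Linear independence of the reductions of automorphisms -/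

section Dedekind

open IsLocalRing

variable {p : ℕ} [Fact p.Prime] {K L : Type*} [Field K] [Algebra ℚ_[p] K] [Field L]
  [Algebra ℚ_[p] L] [Algebra.IsAlgebraic ℚ_[p] L] [Algebra K L] [IsScalarTower ℚ_[p] K L]

/-- Let `H` be a finite group of automorphisms that meets the inertia group trivially. An
automorphism `τ` whose reduction is trivial on integral elements fixed by `H` is congruent to an
element of `H` modulo inertia: otherwise, reducing `τ (∑ g, g b) - ∑ g, g b` would give a nontrivial
relation between the distinct characters `red g`, for `g ∈ H`, and `red (τ * g)`. -/
lemma exists_mul_mem_inertia (H : Subgroup Gal(L/K)) [Finite H]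
    (hH : H ⊓ inertia p K L = ⊥) (τ : Gal(L/K))
    (hτ : ∀ x : L, (∀ g ∈ H, g x = x) → absv p L x ≤ 1 → absv p L (τ x - x) < 1) :
    ∃ g ∈ H, g⁻¹ * τ ∈ inertia p K L := by
  classical
  have := Fintype.ofFinite H
  by_contra! hcon
  let χ : Gal(L/K) → (valRing p L →* ResidueField (valRing p L)) := fun σ => (red p σ).toMonoidHom
  have hχ : ∀ {σ σ' : Gal(L/K)}, χ σ = χ σ' ↔ σ⁻¹ * σ' ∈ inertia p K L := by
    intro σ σ'
    rw [← red_eq_iff]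
    exact ⟨fun h => RingHom.ext fun b => DFunLike.congr_fun h b, fun h => by
      simp only [χ, h]⟩
  have hsum : ∀ b : valRing p L, ∑ g : H, χ (τ * g) b = ∑ g : H, χ g b := by
    intro b
    let x : valRing p L := ∑ g : H, ⟨(g : Gal(L/K)) b, (mem_valRing p).2 (absv_map_le _ b)⟩
    have hx : (x : L) = ∑ g : H, (g : Gal(L/K)) b := by
      simp only [x, AddSubmonoidClass.coe_finsetSum]
    have hfix : ∀ h ∈ H, h (x : L) = x := by
      intro h hh
      rw [hx, map_sum]
      exact Fintype.sum_equiv (Equiv.mulLeft (⟨h, hh⟩ : H)) _ _ fun _ => rfl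
    have h1 : red p τ x = residue _ x := by
      rw [red_apply, residue_eq_iff_absv_lt]
      exact hτ x hfix ((mem_valRing p).1 x.2)
    simp only [x, map_sum] at h1
    exact h1
  have hli := linearIndependent_monoidHom (valRing p L) (ResidueField (valRing p L))
  rw [linearIndependent_iff] at hli
  have h0 := hli (∑ g : H, Finsupp.single (χ (τ * g)) 1 - ∑ g : H, Finsupp.single (χ g) 1) (by
    rw [map_sub, map_sum, map_sum, sub_eq_zero]
    ext b
    simpa using hsum b)
  have h1 := DFunLike.congr_fun h0 (χ τ)
  rw [Finsupp.sub_apply, Finsupp.finsetSum_apply, Finsupp.finsetSum_apply,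
    Finset.sum_eq_single (1 : H), Finset.sum_eq_zero] at h1
  · simp at h1
  · intro g _
    rw [Finsupp.single_apply, if_neg]
    exact fun h => hcon g g.2 (hχ.1 h)
  · intro g _ hg
    rw [Finsupp.single_apply, if_neg]
    intro h
    have h2 : (g : Gal(L/K))⁻¹ ∈ H ⊓ inertia p K L :=
      ⟨H.inv_mem g.2, by simpa [mul_assoc] using hχ.1 h⟩
    rw [hH, Subgroup.mem_bot, inv_eq_one] at h2
    exact hg (Subtype.ext h2)
  · exact fun h => absurd (Finset.mem_univ _) h

/-- If `Gal(L/K)` is finite with inertia group of order `q`, a power of `p`, then `N x ^ q` is the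
absolute value of an element of `K` for every `x`. The element of `K` is the trace from the fixed
field of inertia of `Y * B`, where `Y` and `B` are the products of the conjugates under inertia of
`x` and of a suitable integral element `b`. Such a `b` exists by linear independence of the
characters `b ↦ (red σ b) ^ q`, for `σ` modulo inertia. -/
lemma exists_absv_eq_pow_card_inertia [FiniteDimensional K L] [IsGalois K L] {k : ℕ}
    (hk : Nat.card (inertia p K L) = p ^ k) {x : L} (hx : x ≠ 0) :
    ∃ y : K, absv p L (algebraMap K L y) = absv p L x ^ p ^ k := by
  classical
  have := Fintype.ofFinite (inertia p K L)
  have := Fintype.ofFinite (Gal(L/K) ⧸ inertia p K L)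
  rw [Nat.card_eq_fintype_card] at hk
  let nm : L →* L :=
    { toFun := fun b => ∏ τ : inertia p K L, (τ : Gal(L/K)) b
      map_one' := by simp
      map_mul' := fun a b => by simp [Finset.prod_mul_distrib] }
  have hnm : ∀ b, nm b = ∏ τ : inertia p K L, (τ : Gal(L/K)) b := fun _ => rfl
  have hnmfix : ∀ b, ∀ τ ∈ inertia p K L, τ (nm b) = nm b := by
    intro b τ hτ
    rw [hnm, map_prod]
    exact Fintype.prod_equiv (Equiv.mulLeft (⟨τ, hτ⟩ : inertia p K L)) _ _ fun _ => rfl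
  have hnmabs : ∀ b, absv p L (nm b) = absv p L b ^ p ^ k := by
    intro b
    simp only [hnm, map_prod, absv_equiv, Finset.prod_const, Finset.card_univ, hk]
  -- the trace from the fixed field of the inertia group
  have htr : ∀ w : L, (∀ τ ∈ inertia p K L, τ w = w) →
      ∃ y : K, algebraMap K L y = ∑ s : Gal(L/K) ⧸ inertia p K L, s.out w := by
    intro w hw
    have hout : ∀ σ : Gal(L/K), (QuotientGroup.mk σ : Gal(L/K) ⧸ inertia p K L).out w = σ w := by
      intro σ
      obtain ⟨τ, hτ⟩ := QuotientGroup.mk_out_eq_mul (inertia p K L) σ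
      rw [hτ, AlgEquiv.mul_apply, hw τ τ.2]
    refine (IsGalois.mem_range_algebraMap_iff_fixed _).2 fun g => ?_
    rw [map_sum]
    refine Fintype.sum_equiv (MulAction.toPerm g) _ _ fun s => ?_
    obtain ⟨σ, rfl⟩ := QuotientGroup.mk_surjective s
    rw [MulAction.toPerm_apply, hout, MulAction.Quotient.smul_mk, hout]
    rfl
  have hY : nm x ≠ 0 := by
    rw [← (absv p L).pos_iff, hnmabs]
    exact pow_pos ((absv p L).pos hx) _
  let χ : Gal(L/K) ⧸ inertia p K L → (valRing p L →* ResidueField (valRing p L)) := fun s =>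
    (powMonoidHom (p ^ k)).comp (red p s.out).toMonoidHom
  have hχ : Function.Injective χ := by
    intro s t h
    rw [← QuotientGroup.out_eq' s, ← QuotientGroup.out_eq' t, QuotientGroup.eq, ← red_eq_iff]
    refine RingHom.ext fun b => ?_
    have h1 : (red p s.out b) ^ p ^ k = (red p t.out b) ^ p ^ k := DFunLike.congr_fun h b
    rw [← sub_eq_zero, ← sub_pow_char_pow] at h1
    exact sub_eq_zero.1 (pow_eq_zero_iff (pow_ne_zero _ (Fact.out : p.Prime).ne_zero) |>.1 h1)
  have hu : ∀ σ : Gal(L/K), absv p L (σ (nm x) / nm x) = 1 := fun σ => by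
    rw [map_div₀, absv_equiv, div_self ((absv p L).ne_zero hY)]
  let u : Gal(L/K) ⧸ inertia p K L → valRing p L := fun s =>
    ⟨s.out (nm x) / nm x, (mem_valRing p).2 (hu _).le⟩
  have hli := (linearIndependent_monoidHom (valRing p L) (ResidueField (valRing p L))).comp χ hχ
  rw [Fintype.linearIndependent_iff] at hli
  obtain ⟨b, hb⟩ : ∃ b, ∑ s, residue _ (u s) * χ s b ≠ 0 := by
    by_contra! hcon
    have h1 := hli (fun s => residue _ (u s)) (by
      ext b
      simpa using hcon b) (QuotientGroup.mk 1)
    rw [residue_eq_zero_iff_absv_lt] at h1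
    exact absurd (hu _) h1.ne
  obtain ⟨y, hy⟩ := htr (nm x * nm b) fun τ hτ => by
    rw [map_mul, hnmfix _ τ hτ, hnmfix _ τ hτ]
  refine ⟨y, ?_⟩
  let c : Gal(L/K) ⧸ inertia p K L → valRing p L := fun s =>
    ⟨s.out (nm b), (mem_valRing p).2 (by
      rw [absv_equiv, hnmabs]
      exact pow_le_one₀ ((absv p L).nonneg _) ((mem_valRing p).1 b.2))⟩
  have hc : ∀ s, residue _ (c s) = χ s b := by
    intro s
    have h1 : c s = ∏ τ : inertia p K L, ⟨(s.out * τ) b, (mem_valRing p).2 (absv_map_le _ b)⟩ := by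
      apply Subtype.ext
      simp only [c, hnm, map_prod, SubmonoidClass.coe_finsetProd]
      rfl
    have h2 : ∀ τ : inertia p K L, residue (valRing p L)
        ⟨(s.out * τ) b, (mem_valRing p).2 (absv_map_le _ b)⟩ = red p s.out b := by
      intro τ
      rw [← red_apply, (red_eq_iff (σ := s.out * (τ : Gal(L/K))) (τ := s.out)).2]
      simp
    rw [h1, map_prod, Finset.prod_congr rfl fun τ _ => h2 τ, Finset.prod_const, Finset.card_univ,
      hk]
    rfl
  have hfac : algebraMap K L y = nm x * ((∑ s, u s * c s : valRing p L) : L) := by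
    rw [hy, AddSubmonoidClass.coe_finsetSum, Finset.mul_sum]
    refine Finset.sum_congr rfl fun s _ => ?_
    rw [MulMemClass.coe_mul, map_mul]
    simp only [u, c]
    field_simp
  rw [hfac, map_mul, hnmabs]
  have h1 : ¬ absv p L ((∑ s, u s * c s : valRing p L) : L) < 1 := by
    rw [← residue_eq_zero_iff_absv_lt]
    simpa only [map_sum, map_mul, hc] using hb
  rw [le_antisymm ((mem_valRing p).1 (∑ s, u s * c s : valRing p L).2) (not_lt.1 h1), mul_one]

end Dedekind

/-! ### The fields generated by the tree and their Galois groups -/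

section Fields

lemma exists_injective_of_ker_eq {Γ H A : Type*} [Group Γ] [Group H] [Group A] {f : Γ →* H}
    (hf : Function.Surjective f) {g : Γ →* A} (h : f.ker = g.ker) :
    ∃ φ : H →* A, Function.Injective φ := by
  refine ⟨f.liftOfSurjective hf ⟨g, h.le⟩, ?_⟩
  rw [injective_iff_map_eq_one]
  intro x hx
  obtain ⟨σ, rfl⟩ := hf x
  have h1 : g σ = 1 := by
    rw [← hx]
    exact (f.liftOfRightInverse_comp_apply _ (Function.rightInverse_surjInv hf) ⟨g, h.le⟩ σ).symm
  rwa [← MonoidHom.mem_ker, h, MonoidHom.mem_ker]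

variable {p : ℕ} [Fact p.Prime] {K : Type*} [Field K]
  {Ω : Type*} [Field Ω] [Algebra K Ω] [IsAlgClosed Ω]

lemma exists_pow_eq_add (c a : Ω) : ∃ z : ℕ → Ω, z 0 = a ∧ ∀ i, z (i + 1) ^ p = c + z i := by
  choose g hg using fun w : Ω => IsAlgClosed.exists_pow_nat_eq (c + w) (Fact.out : p.Prime).pos
  exact ⟨fun i => Nat.rec a (fun _ w => g w) i, rfl, fun i => hg _⟩

lemma fieldAt_mono (c a : K) : Monotone (fieldAt Ω p c a) := by
  refine monotone_nat_of_le_succ fun m => ?_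
  rw [fieldAt, IntermediateField.adjoin_le_iff]
  intro α hα
  obtain ⟨β, hβ⟩ := IsAlgClosed.exists_pow_nat_eq (algebraMap K Ω c + α) (Fact.out : p.Prime).pos
  have h1 : β ∈ preimages Ω p c a (m + 1) := by
    change (fun z : Ω => z ^ p - algebraMap K Ω c)^[m] (β ^ p - algebraMap K Ω c) = _
    rw [hβ, add_sub_cancel_left]
    exact hα
  have h2 : α = β ^ p - algebraMap K Ω c := by rw [hβ, add_sub_cancel_left]
  rw [h2]
  exact sub_mem (pow_mem (IntermediateField.subset_adjoin _ _ h1) _)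
    (IntermediateField.algebraMap_mem _ _)

variable [Algebra ℚ_[p] K] [Algebra ℚ_[p] Ω] [IsScalarTower ℚ_[p] K Ω]
  [Algebra.IsAlgebraic ℚ_[p] Ω]

namespace IsBranch

variable {c a : K} {ρ : ℝ} {z : ℕ → Ω} (hz : IsBranch (p := p) (algebraMap K Ω c) ρ z)
  (h0 : z 0 = algebraMap K Ω a)
include hz h0

omit [Algebra ℚ_[p] K] [IsScalarTower ℚ_[p] K Ω] in
lemma mem_fieldAt {i m : ℕ} (h : i ≤ m) : z i ∈ fieldAt Ω p c a m :=
  fieldAt_mono c a h (IntermediateField.subset_adjoin _ _ (hz.mem_preimages h0 i))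

variable [IsGalois K Ω] {ζ : K} (hζ : IsPrimitiveRoot ζ p)
include hζ

omit [IsAlgClosed Ω] in
/-- A single branch up to level `m` generates `K_m`. -/
lemma fieldAt_le {m : ℕ} {E : IntermediateField K Ω} (hE : ∀ i ≤ m, z i ∈ E) :
    fieldAt Ω p c a m ≤ E := by
  rw [fieldAt, IntermediateField.adjoin_le_iff, ← InfiniteGalois.fixedField_fixingSubgroup E]
  intro α hα
  rw [SetLike.mem_coe, IntermediateField.mem_fixedField_iff]
  intro σ hσ
  exact hz.fixed_preimage hζ h0 (fun i hi => hσ ⟨z i, hE i hi⟩) hα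

lemma mem_fixingSubgroup_fieldAt_iff {m : ℕ} {σ : Gal(Ω/K)} :
    σ ∈ (fieldAt Ω p c a m).fixingSubgroup ↔ ∀ i ≤ m, σ (z i) = z i := by
  constructor
  · exact fun h i hi => h ⟨z i, hz.mem_fieldAt h0 hi⟩
  · intro h
    have h1 := hz.fieldAt_le h0 hζ (m := m)
      (E := IntermediateField.fixedField (Subgroup.zpowers σ)) fun i hi => by
        rw [IntermediateField.mem_fixedField_iff]
        intro τ hτ
        have h2 : Subgroup.zpowers σ ≤ MulAction.stabilizer Gal(Ω/K) (z i) := by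
          rw [Subgroup.zpowers_le]
          exact h i hi
        exact h2 hτ
    intro x
    exact (IntermediateField.mem_fixedField_iff _ _).1 (h1 x.2) σ (Subgroup.mem_zpowers σ)

omit [IsAlgClosed Ω] in
lemma finiteDimensional_fieldAt (m : ℕ) : FiniteDimensional K (fieldAt Ω p c a m) := by
  have h1 : FiniteDimensional K (IntermediateField.adjoin K (z '' Set.Iic m)) := by
    have := ((Set.finite_Iic m).image z).to_subtype
    exact IntermediateField.finiteDimensional_adjoin fun x _ =>
      Algebra.IsIntegral.isIntegral x
  have h2 := hz.fieldAt_le h0 hζ (m := m) (E := IntermediateField.adjoin K (z '' Set.Iic m))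
    fun i hi => IntermediateField.subset_adjoin _ _ (Set.mem_image_of_mem z hi)
  exact FiniteDimensional.of_injective (IntermediateField.inclusion h2).toLinearMap
    (IntermediateField.inclusion_injective h2)

/-- The tower `K_m` is stationary from level `n + 1` on, if `z n` and `z (n + 1)` are sufficiently
close. -/
lemma fieldInfty_le {n : ℕ} (h : absv p Ω (z (n + 1) - z n) < (lam p * ρ) ^ p) :
    fieldInfty Ω p c a ≤ fieldAt Ω p c a (n + 1) := by
  refine iSup_le fun m => hz.fieldAt_le h0 hζ fun i _ => ?_
  rcases le_or_gt i (n + 1) with hi | hi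
  · exact hz.mem_fieldAt h0 hi
  · rw [← InfiniteGalois.fixedField_fixingSubgroup (fieldAt Ω p c a (n + 1)),
      IntermediateField.mem_fixedField_iff]
    intro σ hσ
    obtain ⟨j, rfl⟩ : ∃ j, i = n + 1 + j := ⟨i - (n + 1), by omega⟩
    exact hz.fixed_of_fixed hζ h (hσ ⟨z (n + 1), hz.mem_fieldAt h0 le_rfl⟩) j

/-- `G(m)` embeds into `(ℤ/pℤ)^m` by means of the characters `chi`. -/
lemma exists_injective_pi (m : ℕ) :
    ∃ φ : G p Ω c a m →* Multiplicative (Fin m → ZMod p), Function.Injective φ := by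
  have : NeZero p := ⟨(Fact.out : p.Prime).ne_zero⟩
  have hcard : Nat.card (rootsOfUnity p K) = p := hζ.card_rootsOfUnity
  let e : rootsOfUnity p K ≃* Multiplicative (ZMod p) :=
    mulEquivOfPrimeCardEq (p := p) hcard (by simp)
  let ψ : Gal(Ω/K) →* (Fin m → rootsOfUnity p K) := MonoidHom.pi fun i => hz.chi hζ h0 i
  obtain ⟨φ, hφ⟩ := exists_injective_of_ker_eq
    (f := AlgEquiv.restrictNormalHom (F := K) (K₁ := Ω) (fieldAt Ω p c a m)) (g := ψ)
    (AlgEquiv.restrictNormalHom_surjective Ω) (by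
      rw [IntermediateField.restrictNormalHom_ker]
      ext σ
      rw [hz.mem_fixingSubgroup_fieldAt_iff h0 hζ, MonoidHom.mem_ker]
      constructor
      · intro h
        ext1 i
        exact hz.chi_eq_one_of_fixed hζ h0 (h (i + 1) i.2)
      · intro h
        exact hz.fixed_of_chi hζ h0 fun i hi => congrFun h ⟨i, hi⟩)
  let e' : (Fin m → rootsOfUnity p K) ≃* Multiplicative (Fin m → ZMod p) :=
    (MulEquiv.piCongrRight fun _ : Fin m => e).trans
      (MulEquiv.piMultiplicative fun _ : Fin m => ZMod p).symm
  exact ⟨e'.toMonoidHom.comp φ, e'.injective.comp hφ⟩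

end IsBranch

end Fields

/-! ### Restriction maps -/

section Restriction

variable {K : Type*} [Field K] {Ω : Type*} [Field Ω] [Algebra K Ω] [IsGalois K Ω]
  {E F : IntermediateField K Ω}

omit [IsGalois K Ω] in
lemma coe_restrictNormalHom [Normal K E] (σ : Gal(Ω/K)) (x : E) :
    (AlgEquiv.restrictNormalHom E σ x : Ω) = σ x :=
  AlgEquiv.restrictNormal_commutes σ E x

omit [IsGalois K Ω] in
lemma res_restrictNormalHom (h : E ≤ F) [Normal K E] [Normal K F] (σ : Gal(Ω/K)) :
    res h (AlgEquiv.restrictNormalHom F σ) = AlgEquiv.restrictNormalHom E σ := by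
  ext x
  rw [coe_res_apply, coe_restrictNormalHom, coe_restrictNormalHom]
  rfl

omit [IsGalois K Ω] in
lemma res_bijective (h : E ≤ F) (h' : F ≤ E) [Normal K E] : Function.Bijective (res h) := by
  obtain rfl := le_antisymm h h'
  have : (res h : Gal(E/K) → Gal(E/K)) = id := by
    ext σ x
    rw [coe_res_apply]
    rfl
  rw [this]
  exact Function.bijective_id

lemma exists_restrictNormalHom_eq [Normal K E] (σ : Gal(E/K)) :
    ∃ τ : Gal(Ω/K), AlgEquiv.restrictNormalHom E τ = σ :=
  AlgEquiv.restrictNormalHom_surjective Ω σ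

variable {p : ℕ} [Fact p.Prime] [Algebra ℚ_[p] K] [Algebra ℚ_[p] Ω] [IsScalarTower ℚ_[p] K Ω]
  [Algebra.IsAlgebraic ℚ_[p] K] [Algebra.IsAlgebraic ℚ_[p] Ω]

lemma absv_coe (x : E) : absv p Ω x = absv p E x :=
  have : IsScalarTower ℚ_[p] E Ω := IsScalarTower.of_algebraMap_eq fun _ => rfl
  absv_algebraMap p x

lemma restrictNormalHom_mem_inertia_iff [Normal K E] {σ : Gal(Ω/K)} :
    AlgEquiv.restrictNormalHom E σ ∈ inertia p K E ↔
      ∀ x ∈ E, absv p Ω x ≤ 1 → absv p Ω (σ x - x) < 1 := by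
  rw [mem_inertia_iff]
  constructor
  · intro h x hx hx1
    have := h ⟨x, hx⟩ (by rwa [← absv_coe])
    rwa [← absv_coe, AddSubgroupClass.coe_sub, coe_restrictNormalHom] at this
  · intro h x hx
    rw [← absv_coe, AddSubgroupClass.coe_sub, coe_restrictNormalHom]
    exact h x x.2 (by rwa [absv_coe])

lemma res_mem_inertia (h : E ≤ F) [Normal K E] [Normal K F] {σ : Gal(F/K)}
    (hσ : σ ∈ inertia p K F) : res h σ ∈ inertia p K E := by
  obtain ⟨τ, rfl⟩ := exists_restrictNormalHom_eq σ
  rw [res_restrictNormalHom, restrictNormalHom_mem_inertia_iff]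
  exact fun x hx => restrictNormalHom_mem_inertia_iff.1 hσ x (h hx)

lemma inertia_eq_top_of_le (h' : F ≤ E) [Normal K E] [Normal K F] (hE : inertia p K E = ⊤) :
    inertia p K F = ⊤ := by
  refine (Subgroup.eq_top_iff' _).2 fun σ => ?_
  obtain ⟨τ, rfl⟩ := exists_restrictNormalHom_eq σ
  have h1 : AlgEquiv.restrictNormalHom E τ ∈ inertia p K E := hE ▸ Subgroup.mem_top _
  rw [restrictNormalHom_mem_inertia_iff] at h1 ⊢
  exact fun x hx => h1 x (h' hx)

/-- If no nontrivial inertia automorphism of `F` fixes `E`, restriction to `E` is a bijection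
between the inertia groups. -/
lemma res_bijOn_inertia (h : E ≤ F) [Normal K E] [Normal K F] [FiniteDimensional K F]
    (hinj : ∀ σ ∈ inertia p K F, res h σ = 1 → σ = 1) :
    Set.BijOn (res h) (inertia p K F) (inertia p K E) := by
  refine ⟨fun σ hσ => res_mem_inertia h hσ, fun σ hσ τ hτ hστ => ?_, fun σ hσ => ?_⟩
  · rw [← inv_mul_eq_one]
    refine hinj _ (mul_mem (inv_mem hσ) hτ) ?_
    rw [map_mul, map_inv, hστ, inv_mul_cancel]
  · obtain ⟨τ, rfl⟩ := exists_restrictNormalHom_eq σ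
    obtain ⟨g, hg, hg'⟩ := exists_mul_mem_inertia (p := p) (res h).ker
      (by
        rw [eq_bot_iff]
        rintro σ ⟨h1, h2⟩
        exact hinj σ h2 h1) (AlgEquiv.restrictNormalHom F τ) (by
        intro x hx hx1
        have hxE : (x : Ω) ∈ E := by
          rw [← InfiniteGalois.fixedField_fixingSubgroup E, IntermediateField.mem_fixedField_iff]
          intro g hg
          rw [← coe_restrictNormalHom]
          refine congrArg Subtype.val (hx _ ?_)
          rw [MonoidHom.mem_ker, res_restrictNormalHom, ← MonoidHom.mem_ker,
            IntermediateField.restrictNormalHom_ker]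
          exact hg
        rw [← absv_coe, AddSubgroupClass.coe_sub, coe_restrictNormalHom]
        exact restrictNormalHom_mem_inertia_iff.1 hσ x hxE (by rwa [absv_coe]))
    refine ⟨_, hg', ?_⟩
    rw [map_mul, map_inv, MonoidHom.mem_ker.1 hg, inv_one, one_mul, res_restrictNormalHom]

end Restriction

/-! ### Inertia at the last level -/

section LastLevel

variable {p : ℕ} [Fact p.Prime] {K : Type*} [Field K] [Algebra ℚ_[p] K]
  {Ω : Type*} [Field Ω] [Algebra K Ω] [Algebra ℚ_[p] Ω] [IsScalarTower ℚ_[p] K Ω]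
  [Algebra.IsAlgebraic ℚ_[p] Ω]

omit [Algebra ℚ_[p] K] [IsScalarTower ℚ_[p] K Ω] in
/-- If `z n` and `z (n + 1)` are at distance at most `(lam p * ρ) ^ p`, adjoining `z (n + 2)` to
`K(z (n + 1))` gives an unramified extension. It is generated by
`t = (z (n + 2) - z (n + 1)) / ((1 - ζ) * z (n + 1))`, which is integral and whose reduction
satisfies an Artin-Schreier equation. An automorphism that multiplies `z (n + 2)` by a nontrivial
root of unity changes `t` by a unit, so it is not in the inertia group. -/
lemma IsBranch.fixed_of_inertia {c : K} {ρ : ℝ} {z : ℕ → Ω}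
    (hz : IsBranch (p := p) (algebraMap K Ω c) ρ z) {ζ : K} (hζ : IsPrimitiveRoot ζ p) {n : ℕ}
    (h : absv p Ω (z (n + 1) - z n) ≤ (lam p * ρ) ^ p) {E : IntermediateField K Ω}
    (h1 : z (n + 1) ∈ E) (h2 : z (n + 2) ∈ E) {σ : Gal(Ω/K)} (hσ : σ (z (n + 1)) = z (n + 1))
    (hI : ∀ x ∈ E, absv p Ω x ≤ 1 → absv p Ω (σ x - x) < 1) : σ (z (n + 2)) = z (n + 2) := by
  have hζ' := hζ.map_of_injective (algebraMap K Ω).injective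
  have hpos : 0 < lam p * ρ := zero_lt_one.trans hz.one_lt
  set d := algebraMap K Ω (1 - ζ) * z (n + 1) with hd
  have hdE : d ∈ E := mul_mem (IntermediateField.algebraMap_mem _ _) h1
  have hσd : σ d = d := by rw [hd, map_mul, σ.commutes, hσ]
  have hdabs : absv p Ω d = lam p * ρ := by
    rw [hd, map_mul, hz.absv_succ, map_sub, map_one, absv_one_sub_root hζ'.pow_eq_one
      (hζ'.ne_one (Fact.out : p.Prime).one_lt)]
  have ht := hI ((z (n + 2) - z (n + 1)) / d) (div_mem (sub_mem h2 h1) hdE) (by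
    rw [map_div₀, hdabs]
    exact div_le_one_of_le₀ (hz.absv_sub_succ_le hζ' h) hpos.le)
  obtain ⟨ξ, hξ, h3⟩ := exists_root_of_pow_eq (p := p) (x := σ (z (n + 2))) (y := z (n + 2)) (by
    rw [← map_pow, hz.pow_succ, map_add, σ.commutes, hσ])
  rw [map_div₀ σ, map_sub σ, hσ, hσd, ← sub_div, sub_sub_sub_cancel_right, map_div₀, hdabs,
    div_lt_one hpos, h3, ← hz.absv_succ (n + 1)] at ht
  have h4 : ξ = 1 := root_eq_of_absv_lt hξ (one_pow _) (w := z (n + 2)) (by simpa using ht)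
  rw [h3, h4, one_mul]

end LastLevel

/-! ### Stability of the tower and ramification -/

section Tower

variable {p : ℕ} [Fact p.Prime] {K : Type*} [Field K] [Algebra ℚ_[p] K]
  [FiniteDimensional ℚ_[p] K] {Ω : Type*} [Field Ω] [Algebra K Ω] [IsAlgClosed Ω] [IsGalois K Ω]
  [Algebra ℚ_[p] Ω] [IsScalarTower ℚ_[p] K Ω] [Algebra.IsAlgebraic ℚ_[p] Ω]

omit [Fact p.Prime] [FiniteDimensional ℚ_[p] K] [Algebra ℚ_[p] K] [IsScalarTower ℚ_[p] K Ω]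
  [IsAlgClosed Ω] [IsGalois K Ω] [Algebra.IsAlgebraic ℚ_[p] Ω] [Algebra ℚ_[p] Ω] in
lemma fieldInfty_normal [Normal K Ω] (c a : K) : Normal K (fieldInfty Ω p c a) :=
  IntermediateField.normal_iSup K Ω _

namespace IsBranch

variable {c a : K} {ρ : ℝ} {z : ℕ → Ω} (hz : IsBranch (p := p) (algebraMap K Ω c) ρ z)
  (h0 : z 0 = algebraMap K Ω a) {ζ : K} (hζ : IsPrimitiveRoot ζ p)
include hz h0 hζ

omit [FiniteDimensional ℚ_[p] K] in
lemma resInfty_bijective {n : ℕ} (h : absv p Ω (z (n + 1) - z n) < (lam p * ρ) ^ p) :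
    Function.Bijective (resInfty p Ω c a (n + 1)) :=
  have := fieldInfty_normal (p := p) (Ω := Ω) c a
  res_bijective _ (hz.fieldInfty_le h0 hζ h)

/-- The order of the inertia group `I(m)` is a power `p ^ k` with `k ≤ m`, and the `p ^ k`-th powers
of absolute values on `K_m` are absolute values of `K`. -/
lemma exists_card_inertia {m : ℕ} {x : Ω} (hx : x ∈ fieldAt Ω p c a m) (hx0 : x ≠ 0) :
    ∃ k ≤ m, Nat.card (I p Ω c a m) = p ^ k ∧ ∃ y : K, absv p K y = absv p Ω x ^ p ^ k := by
  have := hz.finiteDimensional_fieldAt h0 hζ m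
  obtain ⟨φ, hφ⟩ := hz.exists_injective_pi h0 hζ m
  have h1 : Nat.card (I p Ω c a m) ∣ p ^ m := by
    have h2 := Subgroup.card_dvd_of_injective (φ.comp (I p Ω c a m).subtype)
      (hφ.comp Subtype.val_injective)
    have h3 : Nat.card (Multiplicative (Fin m → ZMod p)) = p ^ m := by
      rw [Nat.card_congr Multiplicative.toAdd, Nat.card_fun, Nat.card_zmod, Nat.card_fin]
    rwa [h3] at h2
  obtain ⟨k, hk, hk'⟩ := (Nat.dvd_prime_pow Fact.out).1 h1
  refine ⟨k, hk, hk', ?_⟩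
  have : IsGalois K (fieldAt Ω p c a m) := ⟨⟩
  obtain ⟨y, hy⟩ := exists_absv_eq_pow_card_inertia (p := p) hk'
    (x := (⟨x, hx⟩ : fieldAt Ω p c a m)) (by simpa [Subtype.ext_iff] using hx0)
  refine ⟨y, ?_⟩
  rwa [absv_algebraMap, ← absv_coe] at hy

omit [FiniteDimensional ℚ_[p] K] in
lemma card_le (m : ℕ) : Nat.card (G p Ω c a m) ≤ p ^ m := by
  obtain ⟨φ, hφ⟩ := hz.exists_injective_pi h0 hζ m
  refine (Nat.card_le_card_of_injective φ hφ).trans ?_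
  rw [Nat.card_congr Multiplicative.toAdd, Nat.card_fun, Nat.card_zmod, Nat.card_fin]

/-- If `I(m)` has order `p ^ m`, it is all of `G(m)`, which is then isomorphic to `(ℤ/pℤ)^m`. -/
lemma inertia_eq_top_and_equiv {m : ℕ} (h : Nat.card (I p Ω c a m) = p ^ m) :
    I p Ω c a m = ⊤ ∧ Nonempty (G p Ω c a m ≃* Multiplicative (Fin m → ZMod p)) := by
  have := hz.finiteDimensional_fieldAt h0 hζ m
  have h1 : I p Ω c a m = ⊤ := Subgroup.eq_top_of_le_card _ (h ▸ hz.card_le h0 hζ m)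
  refine ⟨h1, ?_⟩
  obtain ⟨φ, hφ⟩ := hz.exists_injective_pi h0 hζ m
  refine ⟨MulEquiv.ofBijective φ ((Nat.bijective_iff_injective_and_card φ).2 ⟨hφ, ?_⟩)⟩
  rw [Nat.card_congr Multiplicative.toAdd, Nat.card_fun, Nat.card_zmod, Nat.card_fin, ← h, h1,
    Subgroup.card_top]

lemma inertiaInfty_bijOn {n : ℕ} (h : absv p Ω (z (n + 1) - z n) ≤ (lam p * ρ) ^ p) :
    Set.BijOn (resInfty p Ω c a (n + 1)) (IInfty p Ω c a) (I p Ω c a (n + 1)) := by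
  have hn := fieldInfty_normal (p := p) (Ω := Ω) c a
  have hle := hz.fieldInfty_le h0 hζ (n := n + 1)
    ((hz.absv_sub_succ_le (hζ.map_of_injective (algebraMap K Ω).injective) h).trans_lt
      (lt_pow_prime hz.one_lt))
  have hfin := hz.finiteDimensional_fieldAt h0 hζ (n + 2)
  have hfin' : FiniteDimensional K (fieldInfty Ω p c a) :=
    FiniteDimensional.of_injective (IntermediateField.inclusion hle).toLinearMap
      (IntermediateField.inclusion_injective hle)
  refine res_bijOn_inertia _ fun σ hσ hres => ?_
  obtain ⟨τ, rfl⟩ := exists_restrictNormalHom_eq σ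
  rw [res_restrictNormalHom, ← MonoidHom.mem_ker, IntermediateField.restrictNormalHom_ker,
    hz.mem_fixingSubgroup_fieldAt_iff h0 hζ] at hres
  rw [← MonoidHom.mem_ker, IntermediateField.restrictNormalHom_ker]
  refine IntermediateField.fixingSubgroup_antitone hle ?_
  rw [hz.mem_fixingSubgroup_fieldAt_iff h0 hζ]
  intro i hi
  rcases Nat.lt_or_ge i (n + 2) with hi' | hi'
  · exact hres i (by omega)
  · obtain rfl : i = n + 2 := by omega
    exact hz.fixed_of_inertia hζ h
      (fieldAt_le_fieldInfty Ω p c a (n + 2) (hz.mem_fieldAt h0 (by omega)))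
      (fieldAt_le_fieldInfty Ω p c a (n + 2) (hz.mem_fieldAt h0 le_rfl)) (hres _ le_rfl)
      (restrictNormalHom_mem_inertia_iff.1 hσ)

lemma exists_quotient_injective {n : ℕ} (h : absv p Ω (z (n + 1) - z n) < (lam p * ρ) ^ p) :
    ∃ φ : GInfty p Ω c a ⧸ IInfty p Ω c a →* Multiplicative (ZMod p), Function.Injective φ := by
  have hle := hz.fieldInfty_le h0 hζ h
  have hfin := hz.finiteDimensional_fieldAt h0 hζ (n + 1)
  have hfin' : FiniteDimensional K (fieldInfty Ω p c a) :=
    FiniteDimensional.of_injective (IntermediateField.inclusion hle).toLinearMap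
      (IntermediateField.inclusion_injective hle)
  have hfin'' : FiniteDimensional ℚ_[p] (fieldInfty Ω p c a) := FiniteDimensional.trans _ K _
  obtain ⟨φ, hφ⟩ := hz.exists_injective_pi h0 hζ (n + 1)
  refine exists_quotient_inertia_injective fun σ =>
    (hφ.comp (hz.resInfty_bijective h0 hζ h).1) ?_
  rw [Function.comp_apply, Function.comp_apply, map_pow, map_pow, map_one, map_one]
  refine Multiplicative.toAdd.injective (funext fun i => ?_)
  simp

end IsBranch

end Tower

/-! ### The cutoff values -/

section Cutoff

variable {p : ℕ} [Fact p.Prime]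

/-- For `0 < m` and `N c = p ^ x`, with `D = lam p * N c ^ (1 / p)`, the sign of this quantity
compares `N c ^ (1 / p ^ m)` with `D ^ p`. -/
lemma cutoff_identity {m : ℕ} (hm : 0 < m) (x : ℝ) :
    x - p / ((p : ℝ) - 1) - x / (p : ℝ) ^ m =
      ((p : ℝ) ^ m - 1) / (p : ℝ) ^ m *
        (x - (p : ℝ) ^ (m + 1) / (((p : ℝ) ^ m - 1) * ((p : ℝ) - 1))) := by
  have hp := one_lt_natCast_prime (p := p)
  have h1 : (p : ℝ) - 1 ≠ 0 := by linarith
  have h2 : (p : ℝ) ^ m - 1 ≠ 0 := by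
    have := one_lt_pow₀ hp hm.ne'
    linarith
  have h3 : (p : ℝ) ^ m ≠ 0 := by positivity
  rw [pow_succ]
  field_simp
  ring

lemma cutoff_factor_pos {m : ℕ} (hm : 0 < m) : 0 < ((p : ℝ) ^ m - 1) / (p : ℝ) ^ m := by
  have hp := one_lt_natCast_prime (p := p)
  have := one_lt_pow₀ hp hm.ne'
  exact div_pos (by linarith) (by positivity)

lemma lam_mul_rpow_pow (x : ℝ) :
    (lam p * (p : ℝ) ^ (x / p)) ^ p = (p : ℝ) ^ (x - p / ((p : ℝ) - 1)) := by
  have hp := one_lt_natCast_prime (p := p)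
  have h1 : (p : ℝ) - 1 ≠ 0 := by linarith
  rw [lam, ← Real.rpow_add (by linarith), ← Real.rpow_natCast, ← Real.rpow_mul (by linarith)]
  congr 1
  field_simp
  ring

variable {K : Type*} [Field K] [Algebra ℚ_[p] K] [Algebra.IsAlgebraic ℚ_[p] K]

lemma absv_eq_rpow {c : K} (hc : c ≠ 0) :
    absv p K c = (p : ℝ) ^ Real.logb p (absv p K c) := by
  have hp := one_lt_natCast_prime (p := p)
  rw [Real.rpow_logb (by linarith) hp.ne' ((absv p K).pos hc)]

lemma val_div {c : K} (hc : c ≠ 0) :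
    val p c / p = ((-(Real.logb p (absv p K c) / p) : ℝ) : EReal) := by
  rw [val_eq p hc, ← EReal.coe_natCast, ← EReal.coe_div, neg_div]

lemma absv_lt_rpow_iff {a : K} (y : ℝ) :
    ((-y : ℝ) : EReal) < val p a ↔ absv p K a < (p : ℝ) ^ y := by
  have hp := one_lt_natCast_prime (p := p)
  by_cases ha : a = 0
  · simp only [ha, val, if_pos, map_zero]
    exact iff_of_true (EReal.coe_lt_top _) (Real.rpow_pos_of_pos (by linarith) _)
  · rw [val_eq p ha, EReal.coe_lt_coe_iff, neg_lt_neg_iff,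
      Real.logb_lt_iff_lt_rpow hp ((absv p K).pos ha)]

lemma absv_le_rpow_iff {a : K} (y : ℝ) :
    ((-y : ℝ) : EReal) ≤ val p a ↔ absv p K a ≤ (p : ℝ) ^ y := by
  have hp := one_lt_natCast_prime (p := p)
  by_cases ha : a = 0
  · simp only [ha, val, if_pos, map_zero]
    exact iff_of_true le_top (Real.rpow_nonneg (by linarith) _)
  · rw [val_eq p ha, EReal.coe_le_coe_iff, neg_le_neg_iff,
      Real.logb_le_iff_le_rpow hp ((absv p K).pos ha)]

lemma val_eq_pow_mul_val {c y : K} (hc : c ≠ 0) {s : ℕ} (h : absv p K y ^ p ^ s = absv p K c) :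
    y ≠ 0 ∧ val p c = (p : EReal) ^ s * val p y := by
  have hy : y ≠ 0 := by
    rintro rfl
    rw [map_zero, zero_pow (pow_ne_zero _ (Fact.out : p.Prime).ne_zero)] at h
    exact (absv p K).ne_zero hc h.symm
  refine ⟨hy, ?_⟩
  rw [val_eq p hc, val_eq p hy, ← h, Real.logb_pow, ← EReal.coe_natCast, ← EReal.coe_pow,
    ← EReal.coe_mul]
  congr 1
  push_cast
  ring

end Cutoff

end LocalArboreal

open LocalArboreal in
theorem theorem4p5 (p : ℕ) [Fact p.Prime]
    (K : Type*) [Field K] [Algebra ℚ_[p] K] [FiniteDimensional ℚ_[p] K]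
    (Ω : Type*) [Field Ω] [Algebra K Ω] [IsAlgClosure K Ω]
    [Algebra ℚ_[p] Ω] [IsScalarTower ℚ_[p] K Ω]
    (hμ : ∀ ζ : Ω, ζ ^ p = 1 → ∃ z : K, algebraMap K Ω z = ζ)
    (a c : K) (hc : c ≠ 0) (n : ℕ) (hn : 1 ≤ n) :
    (nu p (n - 1) < val p c →
      val p c < nu p n →
      val p c / p < val p a →
      Function.Bijective (resInfty p Ω c a n) ∧
      (∀ r : ℕ,
        IsGreatest {s : ℕ | ∃ x : K, x ≠ 0 ∧
          val p c = (p : EReal) ^ s * val p x} r →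
        (p : ℝ) ^ ((n : ℤ) - (r : ℤ)) ≤ Nat.card (I p Ω c a n) ∧
        Nat.card (I p Ω c a n) ≤ Nat.card (G p Ω c a n) ∧
        Nat.card (G p Ω c a n) = Nat.card (GInfty p Ω c a) ∧
        Nat.card (G p Ω c a n) ≤ p ^ n) ∧
      ((¬ ∃ x : K, x ≠ 0 ∧ val p c = p * val p x) →
        IInfty p Ω c a = ⊤ ∧ I p Ω c a n = ⊤ ∧
        Nonempty (G p Ω c a n ≃* Multiplicative (Fin n → ZMod p)))) ∧
    (val p c = nu p n →
      val p c / p ≤ val p a →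
      Function.Bijective (resInfty p Ω c a (n + 1)) ∧
      (∃ φ : G p Ω c a (n + 1) →* Multiplicative (Fin (n + 1) → ZMod p),
        Function.Injective φ) ∧
      Set.BijOn (resInfty p Ω c a n)
        (IInfty p Ω c a) (I p Ω c a n) ∧
      (∃ φ : I p Ω c a n →* Multiplicative (Fin n → ZMod p),
        Function.Injective φ) ∧
      (∃ φ : GInfty p Ω c a ⧸ IInfty p Ω c a →*
          Multiplicative (ZMod p),
        Function.Injective φ)) := by
  have hp := one_lt_natCast_prime (p := p)
  have hp0 : (0 : ℝ) < p := by linarith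
  have hKΩ : Algebra.IsAlgebraic K Ω := IsAlgClosure.isAlgebraic
  have hQΩ : Algebra.IsAlgebraic ℚ_[p] Ω := Algebra.IsAlgebraic.trans ℚ_[p] K Ω
  have hclosed : IsAlgClosed Ω := IsAlgClosure.isAlgClosed K
  have hchar : CharZero K := charZero_of_injective_algebraMap (algebraMap ℚ_[p] K).injective
  have hcharΩ : CharZero Ω := charZero_of_injective_algebraMap (algebraMap K Ω).injective
  have hGal : IsGalois K Ω := inferInstance
  obtain ⟨ζ, hζ⟩ : ∃ ζ : K, IsPrimitiveRoot ζ p := by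
    have : NeZero p := ⟨(Fact.out : p.Prime).ne_zero⟩
    obtain ⟨ξ, hξ⟩ := HasEnoughRootsOfUnity.exists_primitiveRoot Ω p
    obtain ⟨ζ, rfl⟩ := hμ ξ hξ.pow_eq_one
    exact ⟨ζ, hξ.of_map_of_injective (algebraMap K Ω).injective⟩
  have hζΩ := hζ.map_of_injective (algebraMap K Ω).injective
  obtain ⟨m, rfl⟩ : ∃ m, n = m + 1 := ⟨n - 1, by omega⟩
  rw [Nat.add_sub_cancel]
  set x := Real.logb p (absv p K c) with hx
  have hcx : absv p K c = (p : ℝ) ^ x := absv_eq_rpow hc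
  have hνm : nu p (m + 1) = ((-((p : ℝ) ^ (m + 1 + 1) / (((p : ℝ) ^ (m + 1) - 1) *
      ((p : ℝ) - 1))) : ℝ) : EReal) := if_neg m.succ_ne_zero
  set ρ := (p : ℝ) ^ (x / p) with hρ
  -- `R` is the absolute value of `z n - z (n - 1)` in the totally ramified situation
  set R := (p : ℝ) ^ (x / (p : ℝ) ^ (m + 1)) with hR
  have hRρ : R ^ p ^ m = ρ := by
    rw [hR, hρ, ← Real.rpow_natCast, ← Real.rpow_mul hp0.le]
    congr 1
    push_cast
    rw [pow_succ]
    field_simp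
  have hRc : R ^ p ^ (m + 1) = absv p K c := by
    rw [hcx, hR, ← Real.rpow_natCast, ← Real.rpow_mul hp0.le]
    congr 1
    push_cast
    field_simp
  have hid := cutoff_identity (p := p) (m := m + 1) m.succ_pos x
  have hfac := cutoff_factor_pos (p := p) (m := m + 1) m.succ_pos
  have hcut : 0 < (p : ℝ) ^ (m + 1 + 1) / (((p : ℝ) ^ (m + 1) - 1) * ((p : ℝ) - 1)) := by
    have : 1 < (p : ℝ) ^ (m + 1) := one_lt_pow₀ hp m.succ_ne_zero
    exact div_pos (by positivity) (mul_pos (by linarith) (by linarith))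
  have hR1 : 0 < x → 1 < R := fun h => Real.one_lt_rpow hp (by positivity)
  have hbranch : 1 < R → R ≤ (lam p * ρ) ^ p → absv p K a ≤ ρ → ∃ z : ℕ → Ω,
      z 0 = algebraMap K Ω a ∧ IsBranch (p := p) (algebraMap K Ω c) ρ z := by
    intro h1 h2 h3
    obtain ⟨z, h0, hz⟩ := exists_pow_eq_add (p := p) (algebraMap K Ω c) (algebraMap K Ω a)
    refine ⟨z, h0, hz, ?_, ?_, ?_⟩
    · rw [absv_algebraMap, ← hRc, pow_succ, pow_mul, hRρ]
    · refine (one_lt_pow_iff_of_nonneg ?_ (Fact.out : p.Prime).ne_zero).1 (h1.trans_le h2)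
      exact mul_nonneg lam_pos.le (Real.rpow_nonneg hp0.le _)
    · rwa [h0, absv_algebraMap]
  rw [val_div hc, ← hx]
  refine ⟨fun h1 h2 h3 => ?_, fun h2 h3 => ?_⟩
  · rw [absv_lt_rpow_iff] at h3
    rw [hνm, val_eq p hc, ← hx, EReal.coe_lt_coe_iff, neg_lt_neg_iff] at h2
    have hx0 : 0 < x := hcut.trans h2
    have hRD : R < (lam p * ρ) ^ p := by
      rw [lam_mul_rpow_pow]
      refine Real.rpow_lt_rpow_of_exponent_lt hp ?_
      have := mul_pos hfac (sub_pos.2 h2)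
      rw [← hid] at this
      linarith
    have hDR : 0 < m → lam p * ρ < R := by
      intro hm
      refine lt_of_pow_lt_pow_left₀ p (Real.rpow_nonneg hp0.le _) ?_
      have h4 : R ^ p = (p : ℝ) ^ (x / (p : ℝ) ^ m) := by
        rw [hR, ← Real.rpow_natCast, ← Real.rpow_mul hp0.le]
        congr 1
        rw [pow_succ]
        field_simp
      rw [lam_mul_rpow_pow, h4]
      refine Real.rpow_lt_rpow_of_exponent_lt hp ?_
      rw [nu, if_neg hm.ne', val_eq p hc, ← hx, EReal.coe_lt_coe_iff, neg_lt_neg_iff] at h1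
      have := mul_neg_of_pos_of_neg (cutoff_factor_pos (p := p) hm) (sub_neg.2 h1)
      rw [← cutoff_identity hm] at this
      linarith
    obtain ⟨z, h0, hz⟩ := hbranch (hR1 hx0) hRD.le h3.le
    have hdist : absv p Ω (z (m + 1) - z m) = R := by
      rw [hz.absv_sub_eq hζΩ (hR1 hx0) hRρ hDR (by rwa [h0, absv_algebraMap]) le_rfl,
        Nat.sub_self, pow_zero, pow_one]
    have hbij := hz.resInfty_bijective h0 hζ (hdist ▸ hRD)
    have hfin := hz.finiteDimensional_fieldAt h0 hζ (m + 1)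
    obtain ⟨k, hk, hcard, y, hy⟩ := hz.exists_card_inertia h0 hζ (m := m + 1)
      (sub_mem (hz.mem_fieldAt h0 le_rfl) (hz.mem_fieldAt h0 m.le_succ))
      (by rw [← (absv p Ω).pos_iff, hdist]; linarith [hR1 hx0])
    rw [hdist] at hy
    refine ⟨hbij, fun r hr => ⟨?_, Subgroup.card_le_card_group _,
      (Nat.card_congr (Equiv.ofBijective _ hbij)).symm, hz.card_le h0 hζ _⟩, fun hno => ?_⟩
    · -- `v c = p ^ (m + 1 - k) * v y`, hence `m + 1 - k ≤ r`
      have h4 : m + 1 - k ≤ r := hr.2 ⟨y, val_eq_pow_mul_val hc (by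
        rw [hy, ← pow_mul, ← pow_add, Nat.add_sub_of_le hk, hRc])⟩
      rw [hcard, Nat.cast_pow, ← zpow_natCast]
      exact zpow_le_zpow_right₀ hp.le (by omega)
    · have hk' : k = m + 1 := by
        by_contra hne
        refine hno ⟨y ^ p ^ (m - k), ?_⟩
        have := val_eq_pow_mul_val (p := p) (y := y ^ p ^ (m - k)) hc (s := 1) (by
          rw [map_pow, hy, ← pow_mul, ← pow_mul, ← pow_add, ← pow_add,
            show k + (m - k + 1) = m + 1 by omega, hRc])
        rwa [pow_one] at this
      rw [hk'] at hcard
      obtain ⟨h5, h6⟩ := hz.inertia_eq_top_and_equiv h0 hζ hcard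
      have := fieldInfty_normal (p := p) (Ω := Ω) c a
      exact ⟨inertia_eq_top_of_le (hz.fieldInfty_le h0 hζ (hdist ▸ hRD)) h5, h5, h6⟩
  · rw [absv_le_rpow_iff] at h3
    rw [hνm, val_eq p hc, ← hx, EReal.coe_eq_coe_iff, neg_inj] at h2
    have hx0 : 0 < x := h2 ▸ hcut
    have hRD : (lam p * ρ) ^ p = R := by
      rw [lam_mul_rpow_pow, hR]
      rw [← h2, sub_self, mul_zero] at hid
      congr 1
      linarith
    obtain ⟨z, h0, hz⟩ := hbranch (hR1 hx0) hRD.ge h3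
    have hdist : absv p Ω (z (m + 1) - z m) ≤ (lam p * ρ) ^ p := by
      have := hz.absv_sub_le_pow hζΩ (hR1 hx0) hRρ
        ((lt_pow_prime hz.one_lt).le.trans hRD.le) (le_refl m)
      rwa [Nat.sub_self, pow_zero, pow_one, ← hRD] at this
    have hdist' : absv p Ω (z (m + 1 + 1) - z (m + 1)) < (lam p * ρ) ^ p :=
      (hz.absv_sub_succ_le hζΩ hdist).trans_lt (lt_pow_prime hz.one_lt)
    obtain ⟨φ, hφ⟩ := hz.exists_injective_pi h0 hζ (m + 1)
    exact ⟨hz.resInfty_bijective h0 hζ hdist', hz.exists_injective_pi h0 hζ (m + 1 + 1),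
      hz.inertiaInfty_bijOn h0 hζ hdist,
      ⟨φ.comp (I p Ω c a (m + 1)).subtype, hφ.comp Subtype.val_injective⟩,
      hz.exists_quotient_injective h0 hζ hdist'⟩
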